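/- Fix $m\ge 0$ colors $1,\dots,m$ and a finite collection $\mathcal G$ of colored chains $g=(i_1\prec\cdots\prec i_\ell)$, with all $\ell\ge 2$ and all $i_j\in\{1,\dots,m\}$. A colored subset of a finite poset $P$ is a subset $S\subseteq P$ with a coloring $c:S\to\{1,\dots,m\}$; it is valid if there is no $g=(i_1\prec\cdots\prec i_\ell)\in\mathcal G$ for which there are $x_1<\cdots<x_\ell$ in $S$ with $c(x_j)=i_j$ for all $j$. A template on $P$ is a function $T:P\to\mathcal P(\{1,\dots,m\})$; it is valid if every coloring $c$ of its support $\{x: T(x)\ne\emptyset\}$ with $c(x)\in T(x)$ for all $x$ is valid. Suppose that $\mathcal G$ is sparse, i.e. that for every color $i$ it contains a monochromatic chain $(i\prec\cdots\prec i)$. Let $\overline p=(p_1,\dots,p_m)$ with $p_i\ge 0$ and $\sum_i p_i\le 1$, and put $$\omega_{crit}(\overline p)=\max_T\ \sum_{x}\log\Bigl(1+\sum_{i\in T(x)}p_i\Bigr),$$ where $T$ ranges over all valid templates on finite chain posets (totally ordered sets of any finite size) and $x$ ranges over the elements of the chain poset. **Theorem.** The maximum defining $\omega_{crit}(\overline p)$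 is attained. Color each element of $(\mathcal P([n]),\subseteq)$ independently with color $i$ with probability $p_i$, and leave it uncolored with probability $1-\sum_i p_i$. Let $V$ be the number of subsets $S\subseteq\mathcal P([n])$ all of whose elements are colored and which are valid with the colors they receive. Then, as $n\to\infty$ with $m,\mathcal G,\overline p$ fixed, $$\mathbb E(V)=e^{\omega_{crit}(\overline p)\binom{n}{\lfloor n/2\rfloor}(1+o(1))}.$$ -/

import Mathlib

open MeasureTheory ProbabilityTheory Filter Topology

namespace ColoredChains

/-- A colored subset of `P` with colors `Fin m` is a partial function from `P` to `Fin m`: the value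
`none` means that the point is not in the subset, and `some i` that it is in it and has color `i`. -/
abbrev ColoredSubset (P : Type*) (m : ℕ) : Type _ := P → Option (Fin m)

/-- The colored chain poset `i₁ ≺ ⋯ ≺ i_ℓ`, given by the list `g = [i₁, …, i_ℓ]` of its colors from
bottom to top, appears in the colored subset `c` as a colored subchain: there are
`x₁ < ⋯ < x_ℓ` in the subset such that `x_j` has color `i_j`. -/
def Appears {P : Type*} [Preorder P] {m : ℕ} (g : List (Fin m)) (c : ColoredSubset P m) : Prop :=
  ∃ x : Fin g.length → P, StrictMono x ∧ ∀ j, c (x j) = some (g.get j)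

/-- `c` avoids all colored chains from `G`. -/
def IsValid {P : Type*} [Preorder P] {m : ℕ} (G : Finset (List (Fin m)))
    (c : ColoredSubset P m) : Prop :=
  ∀ g ∈ G, ¬ Appears g c

/-- `G` contains a monochromatic chain of every color. -/
def IsSparse {m : ℕ} (G : Finset (List (Fin m))) : Prop :=
  ∀ i : Fin m, ∃ l : ℕ, List.replicate l i ∈ G

/-- A template on `P` assigns to every point a set of colors. -/
abbrev Template (P : Type*) (m : ℕ) : Type _ := P → Finset (Fin m)

/-- `c` is a coloring of the support `{x | T x ≠ ∅}` of `T` which assigns to each point `x` of the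
support an element of `T x` (and points outside the support are not in the subset). -/
def Template.IsColoringOfSupport {P : Type*} {m : ℕ} (T : Template P m)
    (c : ColoredSubset P m) : Prop :=
  ∀ x, (T x = ∅ → c x = none) ∧ (T x ≠ ∅ → ∃ i ∈ T x, c x = some i)

/-- A template is valid if every coloring of its support by allowed colors is valid. -/
def Template.IsValid {P : Type*} [Preorder P] {m : ℕ} (G : Finset (List (Fin m)))
    (T : Template P m) : Prop :=
  ∀ c : ColoredSubset P m, T.IsColoringOfSupport c → ColoredChains.IsValid G c

/-- The weight `∑ₓ log (1 + ∑_{i ∈ T x} βᵢ)` of a template. -/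
noncomputable def Template.weight {P : Type*} [Fintype P] {m : ℕ} (β : Fin m → ℝ)
    (T : Template P m) : ℝ :=
  ∑ x, Real.log (1 + ∑ i ∈ T x, β i)

/-- The weights of all valid templates on finite chain posets. -/
def chainWeights {m : ℕ} (G : Finset (List (Fin m))) (β : Fin m → ℝ) : Set ℝ :=
  {w | ∃ (l : ℕ) (T : Template (Fin l) m), T.IsValid G ∧ T.weight β = w}

/-- The critical weight: the maximum of `chainWeights G β`. -/
noncomputable def omegaCrit {m : ℕ} (G : Finset (List (Fin m))) (β : Fin m → ℝ) : ℝ :=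
  sSup (chainWeights G β)

open Classical in
/-- The set `S` with the colors that it inherits from the partial coloring `χ`. -/
noncomputable def restrict {P : Type*} {m : ℕ} (χ : P → Option (Fin m)) (S : Set P) :
    ColoredSubset P m :=
  fun x => if x ∈ S then χ x else none

/-- The number of validly colored subsets of `P` under the partial coloring `χ`: the number of sets
`S`, all of whose points are colored, such that `S` with the inherited colors is valid. -/
noncomputable def numValid {P : Type*} [Preorder P] {m : ℕ} (G : Finset (List (Fin m)))
    (χ : P → Option (Fin m)) : ℕ :=
  Set.ncard {S : Set P | (∀ x ∈ S, χ x ≠ none) ∧ IsValid G (restrict χ S)}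

/-- `χ` is a random partial coloring of `P`: independently for all `x`, the point `x` gets color `i`
with probability `p i` (and so stays uncolored with probability `1 - ∑ i, p i`). Here
`Option (Fin m)` carries the discrete σ-algebra. -/
structure IsRandomColoring {P Ω : Type*} [MeasurableSpace Ω] {m : ℕ} (p : Fin m → ℝ)
    (μ : Measure Ω) (χ : P → Ω → Option (Fin m)) : Prop where
  measurable : ∀ x, Measurable[_, ⊤] (χ x)
  indep : iIndepFun (m := fun _ => ⊤) χ μ
  prob : ∀ x i, μ {ω | χ x ω = some i} = ENNReal.ofReal (p i)

end ColoredChains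

/-!
The expectation of `V` is the partition sum `∑ c, ∏ x, p (c x)` over all valid colored subsets `c`.
The lower bound comes from placing an optimal template for chains on consecutive layers in the
middle of the cube: all colored subsets that it allows are valid.

For the upper bound, call the state of a point its color together with the words that are read along
chains strictly above it. Whether two comparable points may have given states is then a condition on
pairs, so that valid colored subsets become independent sets of a conflict graph. The
Kleitman–Winston method covers these by few containers of small maximum degree. A random maximal
chain contains two given comparable proper nonempty sets with probability at most `1 / n` times the
sum of the probabilities that it contains either one, so a container has few conflicts on an average
maximal chain. The points without conflicts form a valid template, of weight at most `ω_crit` on the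
chain, and averaging over all maximal chains as in the LYM inequality bounds the weight of the
container by `(ω_crit + o(1)) * n.choose (n / 2)`.
-/

namespace ColoredChains

open scoped Finset

section PointWeight

variable {ι : Type*} {β : ι → ℝ}

/-- The contribution `log (1 + ∑_{i ∈ A} βᵢ)` of a single point with color set `A` to the weight of
a template. -/
noncomputable def pointWeight (β : ι → ℝ) (A : Finset ι) : ℝ := Real.log (1 + ∑ i ∈ A, β i)

@[simp]
theorem pointWeight_empty (β : ι → ℝ) : pointWeight β ∅ = 0 := by simp [pointWeight]

theorem exp_pointWeight (hβ : 0 ≤ β) (A : Finset ι) :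
    Real.exp (pointWeight β A) = 1 + ∑ i ∈ A, β i :=
  Real.exp_log (by have := Finset.sum_nonneg fun i (_ : i ∈ A) => hβ i; positivity)

theorem pointWeight_nonneg (hβ : 0 ≤ β) (A : Finset ι) : 0 ≤ pointWeight β A :=
  Real.log_nonneg (le_add_of_nonneg_right (Finset.sum_nonneg fun i _ => hβ i))

theorem pointWeight_mono (hβ : 0 ≤ β) : Monotone (pointWeight β) := fun A B hAB => by
  rw [← Real.exp_le_exp, exp_pointWeight hβ, exp_pointWeight hβ]
  gcongr
  exact fun i _ _ => hβ i

theorem pointWeight_union_le [DecidableEq ι] (hβ : 0 ≤ β) (A B : Finset ι) :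
    pointWeight β (A ∪ B) ≤ pointWeight β A + pointWeight β B := by
  have hA : 0 ≤ ∑ i ∈ A, β i := Finset.sum_nonneg fun i _ => hβ i
  have hB : 0 ≤ ∑ i ∈ B, β i := Finset.sum_nonneg fun i _ => hβ i
  have hAB : ∑ i ∈ A ∪ B, β i ≤ ∑ i ∈ A, β i + ∑ i ∈ B, β i := by
    rw [← Finset.sum_union_inter]
    exact le_add_of_nonneg_right (Finset.sum_nonneg fun i _ => hβ i)
  rw [← Real.exp_le_exp, Real.exp_add, exp_pointWeight hβ, exp_pointWeight hβ, exp_pointWeight hβ]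
  linarith [mul_nonneg hA hB]

end PointWeight

section Validity

variable {P : Type*} [Preorder P] {m : ℕ} {G : Finset (List (Fin m))}

theorem appears_of_isChain_of_forall₂ {g : List (Fin m)} {c : ColoredSubset P m} {l : List P}
    (hl : l.IsChain (· < ·)) (h : List.Forall₂ (fun x i => c x = some i) l g) : Appears g c := by
  have hlen := h.length_eq
  exact ⟨fun j => l.get (j.cast hlen.symm),
    fun i j hij => (List.sortedLT_iff_isChain.2 hl).strictMono_get (by simpa using hij),
    fun j => (List.forall₂_iff_get.1 h).2 j (by simp [hlen]) j.2⟩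

theorem Template.isValid_iff {T : Template P m} :
    T.IsValid G ↔ ∀ g ∈ G, ∀ x : Fin g.length → P, StrictMono x → ∃ j, g.get j ∉ T (x j) := by
  constructor
  · intro hT g hg x hx
    by_contra! hxT
    have hcol (y : P) : ∃ o : Option (Fin m), (T y = ∅ → o = none) ∧
        (T y ≠ ∅ → ∃ i ∈ T y, o = some i) := by
      rcases (T y).eq_empty_or_nonempty with hy | ⟨i, hi⟩
      · exact ⟨none, by simp [hy]⟩
      · exact ⟨some i, by simp [Finset.ne_empty_of_mem hi], fun _ => ⟨i, hi, rfl⟩⟩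
    choose c hc using hcol
    refine hT (Function.extend x (some ∘ g.get) c) (fun y => ?_) g hg
      ⟨x, hx, fun j => hx.injective.extend_apply _ _ j⟩
    by_cases hy : ∃ j, x j = y
    · obtain ⟨j, rfl⟩ := hy
      rw [hx.injective.extend_apply]
      exact ⟨fun h => absurd h (Finset.ne_empty_of_mem (hxT j)), fun _ => ⟨_, hxT j, rfl⟩⟩
    · rw [Function.extend_apply' _ _ _ hy]
      exact hc y
  · rintro h c hc g hg ⟨x, hx, hcx⟩
    obtain ⟨j, hj⟩ := h g hg x hx
    by_cases hT : T (x j) = ∅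
    · simpa [hcx j] using (hc (x j)).1 hT
    · obtain ⟨i, hi, hci⟩ := (hc (x j)).2 hT
      rw [hcx j, Option.some_inj] at hci
      exact hj (hci ▸ hi)

theorem Template.IsValid.comp {Q : Type*} [Preorder Q] {T : Template P m} (hT : T.IsValid G)
    {e : Q → P} (he : StrictMono e) : Template.IsValid G (T ∘ e) :=
  isValid_iff.2 fun g hg x hx => isValid_iff.1 hT g hg (e ∘ x) (he.comp hx)

theorem Template.IsValid.isValid_of_forall_mem {T : Template P m} (hT : T.IsValid G)
    {c : ColoredSubset P m} (hc : ∀ x i, c x = some i → i ∈ T x) :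
    ColoredChains.IsValid G c := by
  rintro g hg ⟨x, hx, hcx⟩
  obtain ⟨j, hj⟩ := isValid_iff.1 hT g hg x hx
  exact hj (hc _ _ (hcx j))

theorem Template.isValid_empty (hG : [] ∉ G) : Template.IsValid G fun _ : P => ∅ :=
  isValid_iff.2 fun _ hg _ _ =>
    ⟨⟨0, List.length_pos_iff.2 (ne_of_mem_of_not_mem hg hG)⟩, Finset.notMem_empty _⟩

end Validity

section Chains

variable {P : Type*} [PartialOrder P] {m : ℕ} {G : Finset (List (Fin m))} {T : Template P m}
  {C : Finset P}

theorem exists_strictMono_range_eq (hC : IsChain (· ≤ ·) (C : Set P)) :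
    ∃ e : Fin #C → P, StrictMono e ∧ Set.range e = C := by
  classical
  let _ : LinearOrder (C : Set P) := hC.linearOrder
  let e : Fin #C ≃o (C : Set P) := Fintype.orderIsoFinOfCardEq _ (by simp)
  exact ⟨Subtype.val ∘ e, e.strictMono, by rw [e.surjective.range_comp, Subtype.range_coe]⟩

theorem card_lt_of_replicate_mem {i : Fin m} {l : ℕ} (hl : List.replicate l i ∈ G)
    (hT : T.IsValid G) (hC : IsChain (· ≤ ·) (C : Set P)) (hi : ∀ x ∈ C, i ∈ T x) : #C < l := by
  by_contra! hle
  obtain ⟨e, he, hrange⟩ := exists_strictMono_range_eq hC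
  have hlen : (List.replicate l i).length ≤ #C := by simpa using hle
  obtain ⟨j, hj⟩ := Template.isValid_iff.1 hT _ hl (fun j => e (j.castLE hlen))
    (he.comp (Fin.strictMono_castLE hlen))
  exact hj (by simpa using hi _ (Finset.mem_coe.1 (hrange.subset ⟨_, rfl⟩)))

theorem card_le_mul_sup_length (hsp : IsSparse G) (hT : T.IsValid G)
    (hC : IsChain (· ≤ ·) (C : Set P)) (hne : ∀ x ∈ C, T x ≠ ∅) :
    #C ≤ m * G.sup List.length := by
  classical
  have hcover : C ⊆ Finset.univ.biUnion fun i => {x ∈ C | i ∈ T x} := fun x hx => by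
    simpa [hx, Finset.Nonempty] using Finset.nonempty_iff_ne_empty.2 (hne x hx)
  have hcolor (i : Fin m) : #{x ∈ C | i ∈ T x} ≤ G.sup List.length := by
    obtain ⟨l, hl⟩ := hsp i
    refine (card_lt_of_replicate_mem hl hT (hC.mono ?_) fun x hx =>
      (Finset.mem_filter.1 hx).2).le.trans ?_
    · exact Finset.coe_subset.2 (Finset.filter_subset _ _)
    · simpa using Finset.le_sup (f := List.length) hl
  calc #C ≤ #(Finset.univ : Finset (Fin m)) * G.sup List.length :=
        (Finset.card_le_card hcover).trans
          (Finset.card_biUnion_le_card_mul _ _ _ fun i _ => hcolor i)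
    _ = m * G.sup List.length := by rw [Finset.card_univ, Fintype.card_fin]

theorem exists_template_weight_eq_sum (hT : T.IsValid G) (hC : IsChain (· ≤ ·) (C : Set P))
    (β : Fin m → ℝ) :
    ∃ T' : Template (Fin #C) m, T'.IsValid G ∧ T'.weight β = ∑ x ∈ C, pointWeight β (T x) := by
  classical
  obtain ⟨e, he, hrange⟩ := exists_strictMono_range_eq hC
  have himage : Finset.univ.image e = C := Finset.coe_injective (by simpa using hrange)
  refine ⟨T ∘ e, hT.comp he, ?_⟩
  conv_rhs => rw [← himage, Finset.sum_image he.injective.injOn]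
  rfl

theorem sum_pointWeight_mem_chainWeights (hT : T.IsValid G) (hC : IsChain (· ≤ ·) (C : Set P))
    (β : Fin m → ℝ) : ∑ x ∈ C, pointWeight β (T x) ∈ chainWeights G β :=
  ⟨#C, exists_template_weight_eq_sum hT hC β⟩

theorem finite_chainWeights (hsp : IsSparse G) (β : Fin m → ℝ) : (chainWeights G β).Finite := by
  classical
  refine ((Set.finite_le_nat (m * G.sup List.length)).biUnion fun l _ =>
    Set.finite_range fun T : Template (Fin l) m => T.weight β).subset ?_
  rintro w ⟨l, T, hT, rfl⟩
  let C : Finset (Fin l) := {x | T x ≠ ∅}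
  have hC : IsChain (· ≤ ·) (C : Set (Fin l)) := fun x _ y _ _ => le_total x y
  have hcard := card_le_mul_sup_length hsp hT hC fun x hx => (Finset.mem_filter.1 hx).2
  obtain ⟨T', -, hT'⟩ := exists_template_weight_eq_sum hT hC β
  have hsum : ∑ x ∈ C, pointWeight β (T x) = T.weight β :=
    Finset.sum_subset (Finset.subset_univ _) fun x _ hx => by
      rw [show T x = ∅ by simpa [C] using hx, pointWeight_empty]
  exact Set.mem_biUnion hcard ⟨T', hT'.trans hsum⟩

theorem isGreatest_omegaCrit (hG : [] ∉ G) (hsp : IsSparse G) (β : Fin m → ℝ) :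
    IsGreatest (chainWeights G β) (omegaCrit G β) := by
  have hne : (chainWeights G β).Nonempty :=
    ⟨_, 0, fun _ => ∅, Template.isValid_empty hG, rfl⟩
  have hfin := finite_chainWeights hsp β
  exact ⟨hne.csSup_mem hfin, fun w hw => le_csSup hfin.bddAbove hw⟩

theorem sum_pointWeight_le_omegaCrit (hsp : IsSparse G) (hT : T.IsValid G)
    (hC : IsChain (· ≤ ·) (C : Set P)) (β : Fin m → ℝ) :
    ∑ x ∈ C, pointWeight β (T x) ≤ omegaCrit G β :=
  le_csSup (finite_chainWeights hsp β).bddAbove (sum_pointWeight_mem_chainWeights hT hC β)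

end Chains

section States

variable {P : Type*} {m : ℕ} {G : Finset (List (Fin m))}

/-- A state of a point of a colored subset: its color together with the words that are read along
chains strictly above the point. -/
abbrev State (m : ℕ) : Type := Fin m × Finset (List (Fin m))

open Classical in
/-- The suffixes of the words in `G`, together with the empty word (which is needed if `G = ∅`). -/
noncomputable def suffixes (G : Finset (List (Fin m))) : Finset (List (Fin m)) :=
  insert [] (G.biUnion fun g => g.tails.toFinset)

theorem mem_suffixes {u : List (Fin m)} : u ∈ suffixes G ↔ u = [] ∨ ∃ g ∈ G, u <:+ g := by
  simp [suffixes]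

theorem mem_suffixes_of_cons {i : Fin m} {u : List (Fin m)} (h : i :: u ∈ suffixes G) :
    u ∈ suffixes G := by
  rw [mem_suffixes] at h ⊢
  rcases h with h | ⟨g, hg, h⟩
  · simp at h
  · exact Or.inr ⟨g, hg, (List.suffix_cons i u).trans h⟩

/-- The relation that the states `q`, `q'` of two points `x < y` of a valid colored subset satisfy:
the words read from `y` upwards, starting with the color of `y`, are also read above `x`, and no
word in `G` is read from `x` upwards. -/
def Compatible (G : Finset (List (Fin m))) (q q' : State m) : Prop :=
  [] ∈ q'.2 ∧ (∀ u ∈ q'.2, q'.1 :: u ∈ suffixes G → q'.1 :: u ∈ q.2) ∧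
    ∀ u ∈ q.2, q.1 :: u ∉ G

theorem map_fst_mem_of_isChain_compatible {q : State m} {l : List (State m)} (hl : l ≠ [])
    (hc : (q :: l).IsChain (Compatible G)) (hs : l.map Prod.fst ∈ suffixes G) :
    l.map Prod.fst ∈ q.2 := by
  induction l generalizing q with
  | nil => exact absurd rfl hl
  | cons q' l ih =>
    obtain ⟨⟨hnil, hread, -⟩, hc'⟩ := List.isChain_cons_cons.1 hc
    refine hread _ ?_ hs
    rcases eq_or_ne l [] with rfl | hl'
    · exact hnil
    · exact ih hl' hc' (mem_suffixes_of_cons hs)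

theorem map_fst_notMem_of_isChain_compatible {l : List (State m)} (hlen : 2 ≤ l.length)
    (hc : l.IsChain (Compatible G)) : l.map Prod.fst ∉ G := by
  match l, hlen with
  | q :: q' :: l, _ =>
    intro hG
    have hsuff : (q' :: l).map Prod.fst ∈ suffixes G :=
      mem_suffixes.2 (Or.inr ⟨_, hG, List.suffix_cons _ _⟩)
    have hread := map_fst_mem_of_isChain_compatible (List.cons_ne_nil _ _) hc hsuff
    exact (List.isChain_cons_cons.1 hc).1.2.2 _ hread hG

open Classical in
/-- The words in `suffixes G` that are read along chains strictly above `x`. -/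
noncomputable def wordsAbove [Preorder P] (G : Finset (List (Fin m))) (c : ColoredSubset P m)
    (x : P) : Finset (List (Fin m)) :=
  {u ∈ suffixes G |
    ∃ l : List P, (x :: l).IsChain (· < ·) ∧ List.Forall₂ (fun y i => c y = some i) l u}

theorem compatible_wordsAbove [Preorder P] {c : ColoredSubset P m} (hc : IsValid G c) {x y : P}
    (hxy : x < y) {i j : Fin m} (hx : c x = some i) (hy : c y = some j) :
    Compatible G (i, wordsAbove G c x) (j, wordsAbove G c y) := by
  simp only [Compatible, wordsAbove, Finset.mem_filter]
  refine ⟨⟨mem_suffixes.2 (Or.inl rfl), [], by simp, by simp⟩, ?_, ?_⟩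
  · rintro u ⟨-, l, hl, hu⟩ hs
    exact ⟨hs, y :: l, List.isChain_cons_cons.2 ⟨hxy, hl⟩, List.Forall₂.cons hy hu⟩
  · rintro u ⟨-, l, hl, hu⟩ hG
    exact hc _ hG (appears_of_isChain_of_forall₂ hl (List.Forall₂.cons hx hu))

open Classical in
/-- All states that can occur in a colored subset. -/
noncomputable def states (G : Finset (List (Fin m))) : Finset (State m) :=
  Finset.univ ×ˢ (suffixes G).powerset

theorem wordsAbove_mem_states [Preorder P] (c : ColoredSubset P m) (x : P) (i : Fin m) :
    (i, wordsAbove G c x) ∈ states G := by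
  classical
  exact Finset.mk_mem_product (Finset.mem_univ i)
    (Finset.mem_powerset.2 (Finset.filter_subset _ _))

/-- The graph in which two points with states are adjacent if they are comparable and their states
cannot occur together in a valid colored subset. -/
def conflictGraph (P : Type*) [Preorder P] (G : Finset (List (Fin m))) :
    SimpleGraph (P × State m) :=
  SimpleGraph.fromRel fun u v => u.1 < v.1 ∧ ¬ Compatible G u.2 v.2

theorem lt_or_gt_of_conflictGraph_adj [Preorder P] {u v : P × State m}
    (h : (conflictGraph P G).Adj u v) : u.1 < v.1 ∨ v.1 < u.1 :=
  h.2.imp And.left And.left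

theorem isIndepSet_conflictGraph_iff [Preorder P] {F : Set (P × State m)} :
    (conflictGraph P G).IsIndepSet F ↔
      ∀ u ∈ F, ∀ v ∈ F, u.1 < v.1 → Compatible G u.2 v.2 := by
  constructor
  · intro hF u hu v hv huv
    have hne : u ≠ v := fun h => huv.ne (congrArg Prod.fst h)
    by_contra hc
    exact hF hu hv hne ⟨hne, Or.inl ⟨huv, hc⟩⟩
  · rintro hF u hu v hv - ⟨-, ⟨huv, hc⟩ | ⟨hvu, hc⟩⟩
    · exact hc (hF u hu v hv huv)
    · exact hc (hF v hv u hu hvu)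

open Classical in
/-- The template that allows at a point the colors of all states attached to it by `F`. -/
noncomputable def colorsOf (F : Finset (P × State m)) : Template P m :=
  fun x => {i | ∃ A, (x, i, A) ∈ F}

theorem mem_colorsOf {F : Finset (P × State m)} {x : P} {i : Fin m} :
    i ∈ colorsOf F x ↔ ∃ A, (x, i, A) ∈ F := by
  simp [colorsOf]

theorem isValid_colorsOf [Preorder P] (hG : ∀ g ∈ G, 2 ≤ g.length) {F : Finset (P × State m)}
    (hF : (conflictGraph P G).IsIndepSet F) : (colorsOf F).IsValid G := by
  refine Template.isValid_iff.2 fun g hg x hx => ?_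
  by_contra! hcol
  choose A hA using fun j => mem_colorsOf.1 (hcol j)
  let l : List (State m) := List.ofFn fun j => (g.get j, A j)
  have hl : l.IsChain (Compatible G) := List.Pairwise.isChain <| List.pairwise_ofFn.2 fun i j hij =>
    isIndepSet_conflictGraph_iff.1 hF _ (hA i) _ (hA j) (hx hij)
  have hmap : l.map Prod.fst = g := by
    rw [List.map_ofFn]
    exact List.ofFn_get g
  exact map_fst_notMem_of_isChain_compatible (by simpa [l] using hG g hg) hl (hmap.symm ▸ hg)

end States

section Containers

variable {V : Type*} [DecidableEq V] {H : SimpleGraph V} [DecidableRel H.Adj] {d : ℕ}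
  {A : Finset V}

/-- A container map of the Kleitman–Winston method: a family of subsets of `A` with small maximum
degree, indexed by fingerprints, such that every independent subset of `A` is contained in the
union of a small fingerprint `S` of it and of the container of `S`. -/
structure IsContainerMap (H : SimpleGraph V) [DecidableRel H.Adj] (d : ℕ) (A : Finset V)
    (F : Finset V → Finset V) : Prop where
  subset : ∀ S, F S ⊆ A
  card_adj_lt : ∀ S, ∀ u ∈ F S, #{v ∈ F S | H.Adj u v} < d
  exists_fingerprint : ∀ I ⊆ A, H.IsIndepSet I → ∃ S ⊆ I, #S * d ≤ #A ∧ I ⊆ S ∪ F S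

theorem card_filter_not_adj_add_le {v : V} (hd : d ≤ #{u ∈ A | H.Adj v u}) :
    #{u ∈ A.erase v | ¬ H.Adj v u} + d ≤ #A := by
  have hfilter : {u ∈ A.erase v | H.Adj v u} = {u ∈ A | H.Adj v u} := by
    rw [Finset.filter_erase, Finset.erase_eq_of_notMem]
    simp
  have hsplit := Finset.card_filter_add_card_filter_not (s := A.erase v) (H.Adj v)
  rw [hfilter] at hsplit
  have := A.card_erase_le (a := v)
  omega

/-- A vertex of large degree either is not in the independent set, or its neighbors are not: in the
second case it is put into the fingerprint. -/
theorem IsContainerMap.branch {v : V} (hd : d ≤ #{u ∈ A | H.Adj v u}) {F₀ F₁ : Finset V → Finset V}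
    (h₀ : IsContainerMap H d (A.erase v) F₀)
    (h₁ : IsContainerMap H d {u ∈ A.erase v | ¬ H.Adj v u} F₁) :
    IsContainerMap H d A fun S => if v ∈ S then F₁ (S.erase v) else F₀ S where
  subset S := by
    split_ifs
    · exact (h₁.subset _).trans ((Finset.filter_subset _ _).trans (A.erase_subset v))
    · exact (h₀.subset _).trans (A.erase_subset v)
  card_adj_lt S := by
    split_ifs
    exacts [h₁.card_adj_lt _, h₀.card_adj_lt _]
  exists_fingerprint I hI hind := by
    by_cases hvI : v ∈ I
    · obtain ⟨S, hSI, hcard, hcover⟩ := h₁.exists_fingerprint (I.erase v)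
        (fun u hu => by
          obtain ⟨huv, huI⟩ := Finset.mem_erase.1 hu
          exact Finset.mem_filter.2 ⟨Finset.mem_erase.2 ⟨huv, hI huI⟩, hind hvI huI huv.symm⟩)
        (hind.mono (Finset.coe_subset.2 (I.erase_subset v)))
      have hvS : v ∉ S := fun h => Finset.notMem_erase v I (hSI h)
      refine ⟨insert v S, Finset.insert_subset hvI (hSI.trans (I.erase_subset v)), ?_, ?_⟩
      · rw [Finset.card_insert_of_notMem hvS, add_one_mul]
        exact (Nat.add_le_add_right hcard d).trans (card_filter_not_adj_add_le hd)
      · simpa only [Finset.mem_insert_self, if_true, Finset.erase_insert hvS, Finset.insert_union]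
          using Finset.subset_insert_iff.2 hcover
    · obtain ⟨S, hSI, hcard, hcover⟩ := h₀.exists_fingerprint I
        (Finset.subset_erase.2 ⟨hI, hvI⟩) hind
      refine ⟨S, hSI, hcard.trans A.card_erase_le, ?_⟩
      simpa only [if_neg fun h => hvI (hSI h)] using hcover

theorem exists_isContainerMap (H : SimpleGraph V) [DecidableRel H.Adj] (d : ℕ) (A : Finset V) :
    ∃ F, IsContainerMap H d A F := by
  induction A using Finset.strongInduction with
  | H A ih =>
    by_cases hA : ∀ v ∈ A, #{u ∈ A | H.Adj v u} < d
    · exact ⟨fun _ => A, fun _ => subset_rfl, fun _ => hA,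
        fun I hI _ => ⟨∅, I.empty_subset, by simp, by simpa using hI⟩⟩
    · push Not at hA
      obtain ⟨v, hv, hd⟩ := hA
      obtain ⟨F₀, h₀⟩ := ih (A.erase v) (Finset.erase_ssubset hv)
      obtain ⟨F₁, h₁⟩ := ih {u ∈ A.erase v | ¬ H.Adj v u}
        ((Finset.filter_subset _ _).trans_ssubset (Finset.erase_ssubset hv))
      exact ⟨_, h₀.branch hd h₁⟩

end Containers

section SmallSubsets

variable {V : Type*}

theorem card_filter_card_le_mul_pow_le (A : Finset V) (t : ℕ) {x : ℝ} (hx : 0 ≤ x)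
    (hx1 : x ≤ 1) : #{S ∈ A.powerset | #S ≤ t} * x ^ t ≤ Real.exp (x * #A) := by
  calc #{S ∈ A.powerset | #S ≤ t} * x ^ t = ∑ S ∈ A.powerset with #S ≤ t, x ^ t := by
        rw [Finset.sum_const, nsmul_eq_mul]
    _ ≤ ∑ S ∈ A.powerset with #S ≤ t, x ^ #S :=
        Finset.sum_le_sum fun S hS => pow_le_pow_of_le_one hx hx1 (Finset.mem_filter.1 hS).2
    _ ≤ ∑ S ∈ A.powerset, x ^ #S :=
        Finset.sum_le_sum_of_subset_of_nonneg (Finset.filter_subset _ _) fun S _ _ => by positivity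
    _ = (x + 1) ^ #A := by simpa using Finset.sum_pow_mul_eq_add_pow x 1 A
    _ ≤ Real.exp (x * #A) := by
        rw [mul_comm, Real.exp_nat_mul]
        gcongr
        exact Real.add_one_le_exp x

theorem card_filter_card_mul_le_exp (A : Finset V) {d : ℕ} (hd : 0 < d) :
    (#{S ∈ A.powerset | #S * d ≤ #A} : ℝ) ≤ Real.exp (#A / d * (1 + Real.log d)) := by
  have hd' : (1 : ℝ) ≤ d := mod_cast hd
  have hcount := card_filter_card_le_mul_pow_le A (#A / d) (inv_nonneg.2 d.cast_nonneg)
    (inv_le_one_of_one_le₀ hd')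
  simp only [Nat.le_div_iff_mul_le hd] at hcount
  rw [inv_pow, ← div_eq_mul_inv, div_le_iff₀ (by positivity)] at hcount
  have hpow : (d : ℝ) ^ (#A / d) ≤ Real.exp (#A / d * Real.log d) := by
    rw [← Real.rpow_natCast, Real.rpow_def_of_pos (by positivity), mul_comm]
    gcongr
    exact Nat.cast_div_le
  calc _ ≤ Real.exp ((d : ℝ)⁻¹ * #A) * d ^ (#A / d) := hcount
    _ ≤ Real.exp ((d : ℝ)⁻¹ * #A) * Real.exp (#A / d * Real.log d) := by gcongr
    _ = Real.exp (#A / d * (1 + Real.log d)) := by rw [← Real.exp_add]; ring_nf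

end SmallSubsets

section Numberings

open Numbering

variable {X : Type*} [Fintype X] [DecidableEq X]

open Nat in
theorem card_prefixed_inter_le {s t : Finset X} (hst : s ⊆ t) :
    #(prefixed s ∩ prefixed t) ≤ (#s)! * (#t - #s)! * (Fintype.card X - #t)! := by
  let s' : Finset t := s.subtype (· ∈ t)
  have hcard : #s' = #s := by rw [Finset.card_subtype, Finset.filter_true_of_mem hst]
  let restr (f : ↥(prefixed s ∩ prefixed t)) : Numbering t × Numbering ↥tᶜ :=
    prefixedEquiv t ⟨f, (Finset.mem_inter.1 f.2).2⟩
  have hrestr : restr.Injective := fun f g hfg =>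
    Subtype.ext (Subtype.mk.inj ((prefixedEquiv t).injective hfg))
  have hprefix (f) : (restr f).1 ∈ prefixed s' := mem_prefixed.2 fun z => by
    rw [hcard, Finset.mem_subtype, mem_prefixed.1 (Finset.mem_inter.1 f.2).1 z]
    rfl
  have hle := Finset.card_le_card_of_injOn (s := Finset.univ)
    (t := prefixed s' ×ˢ (Finset.univ : Finset (Numbering ↥tᶜ))) restr
    (fun f _ => Finset.mem_coe.2 (Finset.mk_mem_product (hprefix f) (Finset.mem_univ _)))
    hrestr.injOn
  rw [Finset.card_univ, Fintype.card_coe, Finset.card_product, card_prefixed, hcard,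
    Finset.card_univ, Fintype.card_numbering] at hle
  simpa [Finset.card_compl] using hle

theorem choose_mul_card_prefixed_inter_le_left {s t : Finset X} (hst : s ⊆ t) :
    (Fintype.card X - #s).choose (#t - #s) * #(prefixed s ∩ prefixed t) ≤ #(prefixed s) := by
  have hfac := Nat.choose_mul_factorial_mul_factorial (Nat.sub_le_sub_right t.card_le_univ #s)
  rw [Nat.sub_sub_sub_cancel_right (Finset.card_le_card hst)] at hfac
  refine (Nat.mul_le_mul_left _ (card_prefixed_inter_le hst)).trans_eq ?_
  rw [card_prefixed, ← hfac]
  ring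

theorem choose_mul_card_prefixed_inter_le_right {s t : Finset X} (hst : s ⊆ t) :
    (#t).choose #s * #(prefixed s ∩ prefixed t) ≤ #(prefixed t) := by
  refine (Nat.mul_le_mul_left _ (card_prefixed_inter_le hst)).trans_eq ?_
  rw [card_prefixed, ← Nat.choose_mul_factorial_mul_factorial (Finset.card_le_card hst)]
  ring

theorem le_choose_of_pos_of_lt {n k : ℕ} (hk : 0 < k) (hkn : k < n) : n ≤ n.choose k := by
  induction n generalizing k with
  | zero => omega
  | succ n ih =>
    obtain ⟨k, rfl⟩ := Nat.exists_eq_add_of_le' hk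
    rw [Nat.choose_succ_succ']
    rcases Nat.lt_or_ge (k + 1) n with h | h
    · have := ih (k := k + 1) (by omega) h
      have := Nat.choose_pos (show k ≤ n by omega)
      omega
    · obtain rfl : n = k + 1 := by omega
      simp

/-- Given that a random numbering has `s` as an initial segment, the probability that it also has
`t` is at most `1 / (card X - #s)`, and with `s` and `t` exchanged it is at most `1 / #t`. -/
theorem card_mul_card_prefixed_inter_le {s t : Finset X} (hst : s ⊂ t) (hs : s ≠ ∅)
    (ht : t ≠ Finset.univ) :
    Fintype.card X * #(prefixed s ∩ prefixed t) ≤ #(prefixed s) + #(prefixed t) := by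
  have hs₀ : 0 < #s := Finset.card_pos.2 (Finset.nonempty_iff_ne_empty.2 hs)
  have hlt : #s < #t := Finset.card_lt_card hst
  have htX : #t < Fintype.card X := Finset.card_lt_card (Finset.ssubset_univ_iff.2 ht)
  calc Fintype.card X * #(prefixed s ∩ prefixed t)
      ≤ ((Fintype.card X - #s) + #t) * #(prefixed s ∩ prefixed t) := by gcongr; omega
    _ ≤ ((Fintype.card X - #s).choose (#t - #s) + (#t).choose #s) * #(prefixed s ∩ prefixed t) := by
        gcongr
        · exact le_choose_of_pos_of_lt (by omega) (by omega)
        · exact le_choose_of_pos_of_lt hs₀ hlt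
    _ ≤ #(prefixed s) + #(prefixed t) := by
        rw [add_mul]
        exact Nat.add_le_add (choose_mul_card_prefixed_inter_le_left hst.1)
          (choose_mul_card_prefixed_inter_le_right hst.1)

/-- The initial segments of a numbering of `X`. They form a maximal chain in the power set, and
every maximal chain arises from exactly one numbering in this way. -/
def initialSegments (f : Numbering X) : Finset (Finset X) := {s | IsPrefix f s}

theorem mem_initialSegments {f : Numbering X} {s : Finset X} :
    s ∈ initialSegments f ↔ IsPrefix f s := by
  simp [initialSegments]

theorem isChain_initialSegments (f : Numbering X) :
    IsChain (· ≤ ·) (initialSegments f : Set (Finset X)) := by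
  intro s hs t ht _
  rw [Finset.mem_coe, mem_initialSegments] at hs ht
  exact (le_total #s #t).imp (hs.subset_of_card_le_card ht) (ht.subset_of_card_le_card hs)

theorem factorial_le_choose_half_mul_card_prefixed (s : Finset X) :
    (Fintype.card X).factorial ≤
      (Fintype.card X).choose (Fintype.card X / 2) * #(prefixed s) := by
  rw [card_prefixed, ← Nat.choose_mul_factorial_mul_factorial s.card_le_univ, mul_assoc]
  exact Nat.mul_le_mul_right _ (Nat.choose_le_middle _ _)

theorem factorial_mul_sum_le {w : Finset X → ℝ} (hw : 0 ≤ w) :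
    (Fintype.card X).factorial * ∑ s, w s ≤
      (Fintype.card X).choose (Fintype.card X / 2) *
        ∑ f : Numbering X, ∑ s ∈ initialSegments f, w s := by
  have hswap : ∑ f : Numbering X, ∑ s ∈ initialSegments f, w s = ∑ s, #(prefixed s) * w s := by
    simp_rw [← nsmul_eq_mul, ← Finset.sum_const]
    exact Finset.sum_comm' fun f s => by simp [mem_initialSegments]
  rw [hswap, Finset.mul_sum, Finset.mul_sum]
  refine Finset.sum_le_sum fun s _ => ?_
  rw [← mul_assoc]
  exact mul_le_mul_of_nonneg_right (mod_cast factorial_le_choose_half_mul_card_prefixed s) (hw s)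

end Numberings

section Degrees

variable {V : Type*} {H : SimpleGraph V} [DecidableRel H.Adj] {F : Finset V} {d : ℕ}

/-- The vertices in `F` that have a neighbor in `F`. -/
def nonisolated (H : SimpleGraph V) [DecidableRel H.Adj] (F : Finset V) : Finset V :=
  {u ∈ F | ∃ v ∈ F, H.Adj u v}

theorem isIndepSet_sdiff_nonisolated [DecidableEq V] (H : SimpleGraph V)
    [DecidableRel H.Adj] (F : Finset V) :
    H.IsIndepSet (F \ nonisolated H F : Finset V) := by
  intro u hu v hv _ huv
  obtain ⟨huF, hu⟩ := Finset.mem_sdiff.1 hu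
  exact hu (Finset.mem_filter.2 ⟨huF, v, (Finset.mem_sdiff.1 hv).1, huv⟩)

theorem card_nonisolated_le : #(nonisolated H F) ≤ #{e ∈ F ×ˢ F | H.Adj e.1 e.2} := by
  classical
  refine (Finset.card_le_card fun u hu => ?_).trans (Finset.card_image_le (f := Prod.fst))
  obtain ⟨huF, v, hv, huv⟩ := Finset.mem_filter.1 hu
  exact Finset.mem_image.2 ⟨(u, v), by simp [huF, hv, huv], rfl⟩

theorem sum_adj_add_le (hd : ∀ u ∈ F, #{v ∈ F | H.Adj u v} ≤ d) (w : V → ℕ) :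
    ∑ e ∈ F ×ˢ F with H.Adj e.1 e.2, (w e.1 + w e.2) ≤ 2 * d * ∑ u ∈ F, w u := by
  have hfst : ∑ e ∈ F ×ˢ F with H.Adj e.1 e.2, w e.1 ≤ d * ∑ u ∈ F, w u := by
    rw [Finset.sum_filter, Finset.sum_product, Finset.mul_sum]
    refine Finset.sum_le_sum fun u hu => ?_
    rw [← Finset.sum_filter]
    change ∑ v ∈ F with H.Adj u v, w u ≤ d * w u
    rw [Finset.sum_const, smul_eq_mul]
    exact Nat.mul_le_mul_right _ (hd u hu)
  have hsnd : ∑ e ∈ F ×ˢ F with H.Adj e.1 e.2, w e.2 =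
      ∑ e ∈ F ×ˢ F with H.Adj e.1 e.2, w e.1 :=
    Finset.sum_equiv (Equiv.prodComm V V)
      (fun e => by simp [and_comm, H.adj_comm]) fun _ _ => rfl
  rw [Finset.sum_add_distrib, hsnd, mul_assoc, two_mul]
  exact Nat.add_le_add hfst hfst

end Degrees

section RandomChain

theorem sum_card_filter_mem {α ι : Type*} [Fintype α] [DecidableEq α] (A : ι → Finset α)
    (s : Finset ι) : ∑ a, #{i ∈ s | a ∈ A i} = ∑ i ∈ s, #(A i) :=
  (Finset.sum_card_bipartiteAbove_eq_sum_card_bipartiteBelow fun a i => a ∈ A i).trans <|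
    Finset.sum_congr rfl fun i _ => congrArg Finset.card (Finset.filter_univ_mem (A i))

open Numbering

variable {X Y : Type*} [Fintype X] [DecidableEq X]
  {H : SimpleGraph (Finset X × Y)} [DecidableRel H.Adj] {F : Finset (Finset X × Y)} {d : ℕ}

theorem card_mul_sum_card_nonisolated_le (hH : ∀ u v, H.Adj u v → u.1 < v.1 ∨ v.1 < u.1)
    (hproper : ∀ u ∈ F, u.1 ≠ ∅ ∧ u.1 ≠ Finset.univ) (hd : ∀ u ∈ F, #{v ∈ F | H.Adj u v} ≤ d) :
    Fintype.card X * ∑ f : Numbering X, #(nonisolated H {u ∈ F | f ∈ prefixed u.1}) ≤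
      2 * d * ∑ f : Numbering X, #{u ∈ F | f ∈ prefixed u.1} := by
  let E : Finset ((Finset X × Y) × (Finset X × Y)) := {e ∈ F ×ˢ F | H.Adj e.1 e.2}
  have hpair (e) (he : e ∈ E) : Fintype.card X * #(prefixed e.1.1 ∩ prefixed e.2.1) ≤
      #(prefixed e.1.1) + #(prefixed e.2.1) := by
    obtain ⟨he, hadj⟩ := Finset.mem_filter.1 he
    obtain ⟨h₁, h₂⟩ := Finset.mem_product.1 he
    rcases hH _ _ hadj with hlt | hlt
    · exact card_mul_card_prefixed_inter_le hlt (hproper _ h₁).1 (hproper _ h₂).2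
    · rw [Finset.inter_comm, add_comm]
      exact card_mul_card_prefixed_inter_le hlt (hproper _ h₂).1 (hproper _ h₁).2
  calc Fintype.card X * ∑ f : Numbering X, #(nonisolated H {u ∈ F | f ∈ prefixed u.1})
      ≤ Fintype.card X * ∑ f : Numbering X, #{e ∈ E | f ∈ prefixed e.1.1 ∩ prefixed e.2.1} := by
        gcongr with f
        refine card_nonisolated_le.trans (Finset.card_le_card fun e he => ?_)
        simp only [Finset.mem_filter, Finset.mem_product, Finset.mem_inter, E] at he ⊢
        tauto
    _ = ∑ e ∈ E, Fintype.card X * #(prefixed e.1.1 ∩ prefixed e.2.1) := by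
        rw [sum_card_filter_mem (fun e => prefixed e.1.1 ∩ prefixed e.2.1) E, Finset.mul_sum]
    _ ≤ ∑ e ∈ E, (#(prefixed e.1.1) + #(prefixed e.2.1)) := Finset.sum_le_sum hpair
    _ ≤ 2 * d * ∑ f : Numbering X, #{u ∈ F | f ∈ prefixed u.1} := by
        rw [sum_card_filter_mem (fun u => prefixed u.1) F]
        exact sum_adj_add_le hd fun u => #(prefixed u.1)

end RandomChain

section ChainWeight

variable {P : Type*} {m : ℕ} {G : Finset (List (Fin m))} {β : Fin m → ℝ}
  {F : Finset (P × State m)} {C : Finset P}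

theorem colorsOf_union [DecidableEq P] (F F' : Finset (P × State m)) (x : P) :
    colorsOf (F ∪ F') x = colorsOf F x ∪ colorsOf F' x := by
  ext i
  simp [mem_colorsOf, exists_or]

theorem sum_pointWeight_colorsOf_le_card_mul (hβ : 0 ≤ β) (F : Finset (P × State m))
    (C : Finset P) :
    ∑ x ∈ C, pointWeight β (colorsOf F x) ≤ #F * pointWeight β Finset.univ := by
  classical
  have hzero : ∀ x ∈ C, x ∉ F.image Prod.fst → pointWeight β (colorsOf F x) = 0 := by
    intro x _ hx
    have hempty : colorsOf F x = ∅ := Finset.eq_empty_of_forall_notMem fun i hi =>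
      let ⟨_, hA⟩ := mem_colorsOf.1 hi
      hx (Finset.mem_image_of_mem Prod.fst hA)
    rw [hempty, pointWeight_empty]
  calc ∑ x ∈ C, pointWeight β (colorsOf F x)
      = ∑ x ∈ C with x ∈ F.image Prod.fst, pointWeight β (colorsOf F x) :=
        (Finset.sum_filter_of_ne fun x hx => not_imp_comm.1 (hzero x hx)).symm
    _ ≤ #{x ∈ C | x ∈ F.image Prod.fst} • pointWeight β Finset.univ :=
        Finset.sum_le_card_nsmul _ _ _ fun x _ => pointWeight_mono hβ (Finset.subset_univ _)
    _ ≤ #F * pointWeight β Finset.univ := by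
        rw [nsmul_eq_mul]
        gcongr
        · exact pointWeight_nonneg hβ _
        · refine (Finset.card_le_card fun x hx => ?_).trans (Finset.card_image_le (f := Prod.fst))
          exact (Finset.mem_filter.1 hx).2

theorem sum_pointWeight_colorsOf_union_le [DecidableEq P] (hβ : 0 ≤ β)
    (F S : Finset (P × State m)) (C : Finset P) :
    ∑ x ∈ C, pointWeight β (colorsOf (F ∪ S) x) ≤
      ∑ x ∈ C, pointWeight β (colorsOf F x) + #S * pointWeight β Finset.univ :=
  calc ∑ x ∈ C, pointWeight β (colorsOf (F ∪ S) x)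
      ≤ ∑ x ∈ C, (pointWeight β (colorsOf F x) + pointWeight β (colorsOf S x)) := by
        gcongr with x
        rw [colorsOf_union]
        exact pointWeight_union_le hβ _ _
    _ = ∑ x ∈ C, pointWeight β (colorsOf F x) + ∑ x ∈ C, pointWeight β (colorsOf S x) :=
        Finset.sum_add_distrib
    _ ≤ ∑ x ∈ C, pointWeight β (colorsOf F x) + #S * pointWeight β Finset.univ := by
        gcongr
        exact sum_pointWeight_colorsOf_le_card_mul hβ S C

/-- A bound for the number of pairwise compatible states on the points of a chain. -/
noncomputable def chainStateBound (G : Finset (List (Fin m))) : ℕ :=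
  #(states G) * (m * G.sup List.length)

variable [PartialOrder P]

theorem card_le_chainStateBound_of_isIndepSet (hG : ∀ g ∈ G, 2 ≤ g.length) (hsp : IsSparse G)
    (hC : IsChain (· ≤ ·) (C : Set P)) (hF : F ⊆ C ×ˢ states G)
    (hind : (conflictGraph P G).IsIndepSet F) : #F ≤ chainStateBound G := by
  classical
  have hsupport : #(F.image Prod.fst) ≤ m * G.sup List.length := by
    refine card_le_mul_sup_length hsp (isValid_colorsOf hG hind) (hC.mono fun x hx => ?_) ?_
    · obtain ⟨u, hu, rfl⟩ := Finset.mem_image.1 (Finset.mem_coe.1 hx)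
      exact (Finset.mem_product.1 (hF hu)).1
    · intro x hx
      obtain ⟨u, hu, rfl⟩ := Finset.mem_image.1 hx
      exact Finset.ne_empty_of_mem (mem_colorsOf.2 ⟨u.2.2, hu⟩)
  calc #F ≤ #(F.image Prod.fst ×ˢ states G) := Finset.card_le_card fun u hu =>
        Finset.mem_product.2 ⟨Finset.mem_image_of_mem _ hu, (Finset.mem_product.1 (hF hu)).2⟩
    _ = #(states G) * #(F.image Prod.fst) := by rw [Finset.card_product, mul_comm]
    _ ≤ chainStateBound G := Nat.mul_le_mul_left _ hsupport

open Classical in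
theorem card_le_chainStateBound_add (hG : ∀ g ∈ G, 2 ≤ g.length) (hsp : IsSparse G)
    (hC : IsChain (· ≤ ·) (C : Set P)) (hF : F ⊆ C ×ˢ states G) :
    #F ≤ chainStateBound G + #(nonisolated (conflictGraph P G) F) :=
  (Finset.card_le_card_sdiff_add_card (s := F) (t := nonisolated (conflictGraph P G) F)).trans <|
    Nat.add_le_add_right (card_le_chainStateBound_of_isIndepSet hG hsp hC
      (Finset.sdiff_subset.trans hF) (isIndepSet_sdiff_nonisolated _ F)) _

open Classical in
theorem sum_pointWeight_colorsOf_le (hG : ∀ g ∈ G, 2 ≤ g.length) (hsp : IsSparse G) (hβ : 0 ≤ β)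
    (F : Finset (P × State m)) (hC : IsChain (· ≤ ·) (C : Set P)) :
    ∑ x ∈ C, pointWeight β (colorsOf F x) ≤ omegaCrit G β +
      #(nonisolated (conflictGraph P G) F) * pointWeight β Finset.univ := by
  have hsplit : (F \ nonisolated _ F) ∪ nonisolated (conflictGraph P G) F = F :=
    Finset.sdiff_union_of_subset (Finset.filter_subset _ _)
  have hisolated := sum_pointWeight_le_omegaCrit hsp
    (isValid_colorsOf hG (isIndepSet_sdiff_nonisolated (conflictGraph P G) F)) hC β
  refine (Eq.trans_le (by rw [hsplit]) <| sum_pointWeight_colorsOf_union_le hβ _ _ C).trans ?_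
  gcongr

end ChainWeight

section CubeWeight

open Numbering

variable {X : Type*} [Fintype X] {m : ℕ} {G : Finset (List (Fin m))}
  {β : Fin m → ℝ} {F : Finset (Finset X × State m)} {d : ℕ}

theorem card_univ_numbering [DecidableEq X] :
    #(Finset.univ : Finset (Numbering X)) = (Fintype.card X).factorial := by
  rw [Finset.card_univ, Fintype.card_numbering]

theorem colorsOf_filter_mem_prefixed [DecidableEq X] {f : Numbering X} {s : Finset X}
    (hs : s ∈ initialSegments f) (F : Finset (Finset X × State m)) :
    colorsOf {u ∈ F | f ∈ prefixed u.1} s = colorsOf F s := by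
  have hfs : f ∈ prefixed s := mem_prefixed.2 (mem_initialSegments.1 hs)
  ext i
  simp only [mem_colorsOf, Finset.mem_filter, hfs, and_true]

open Classical in
theorem card_mul_sum_card_nonisolated_le_factorial_mul [DecidableEq X]
    (hG : ∀ g ∈ G, 2 ≤ g.length) (hsp : IsSparse G) (hproper : ∀ u ∈ F, u.1 ≠ ∅ ∧ u.1 ≠ Finset.univ)
    (hstates : ∀ u ∈ F, u.2 ∈ states G)
    (hd : ∀ u ∈ F, #{v ∈ F | (conflictGraph _ G).Adj u v} ≤ d) (hdX : 4 * d ≤ Fintype.card X) :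
    Fintype.card X *
        ∑ f : Numbering X, #(nonisolated (conflictGraph _ G) {u ∈ F | f ∈ prefixed u.1}) ≤
      4 * d * ((Fintype.card X).factorial * chainStateBound G) := by
  set c : Numbering X → ℕ := fun f => #(nonisolated (conflictGraph _ G) {u ∈ F | f ∈ prefixed u.1})
  have hcard : ∑ f : Numbering X, #{u ∈ F | f ∈ prefixed u.1} ≤
      (Fintype.card X).factorial * chainStateBound G + ∑ f, c f := by
    rw [← card_univ_numbering, ← smul_eq_mul, ← Finset.sum_const, ← Finset.sum_add_distrib]
    refine Finset.sum_le_sum fun f _ => card_le_chainStateBound_add hG hsp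
      (isChain_initialSegments f) fun u hu => ?_
    obtain ⟨huF, huf⟩ := Finset.mem_filter.1 hu
    exact Finset.mem_product.2 ⟨mem_initialSegments.2 (mem_prefixed.1 huf), hstates u huF⟩
  have hconf : Fintype.card X * ∑ f, c f ≤
      2 * d * ((Fintype.card X).factorial * chainStateBound G + ∑ f, c f) :=
    (card_mul_sum_card_nonisolated_le (fun _ _ => lt_or_gt_of_conflictGraph_adj) hproper hd).trans
      (Nat.mul_le_mul_left _ hcard)
  have habsorb : 4 * d * ∑ f, c f ≤ Fintype.card X * ∑ f, c f := Nat.mul_le_mul_right _ hdX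
  linarith

open Classical in
theorem weight_colorsOf_le (hG : ∀ g ∈ G, 2 ≤ g.length) (hsp : IsSparse G) (hβ : 0 ≤ β)
    (hproper : ∀ u ∈ F, u.1 ≠ ∅ ∧ u.1 ≠ Finset.univ) (hstates : ∀ u ∈ F, u.2 ∈ states G)
    (hd : ∀ u ∈ F, #{v ∈ F | (conflictGraph _ G).Adj u v} ≤ d) (hdX : 4 * d ≤ Fintype.card X)
    [Nonempty X] :
    (colorsOf F).weight β ≤ (Fintype.card X).choose (Fintype.card X / 2) *
      (omegaCrit G β +
        4 * d / Fintype.card X * chainStateBound G * pointWeight β Finset.univ) := by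
  set n := Fintype.card X
  set L := pointWeight β Finset.univ
  let c : Numbering X → ℕ := fun f => #(nonisolated (conflictGraph _ G) {u ∈ F | f ∈ prefixed u.1})
  have hn : (0 : ℝ) < n := mod_cast Fintype.card_pos
  have hL : 0 ≤ L := pointWeight_nonneg hβ _
  have hc : ∑ f, (c f : ℝ) ≤ n.factorial * (4 * d / n * chainStateBound G) := by
    have h : (n : ℝ) * ∑ f, (c f : ℝ) ≤ 4 * d * (n.factorial * chainStateBound G) := mod_cast
      card_mul_sum_card_nonisolated_le_factorial_mul hG hsp hproper hstates hd hdX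
    calc _ ≤ 4 * d * (n.factorial * chainStateBound G) / (n : ℝ) := (le_div_iff₀' hn).2 h
      _ = _ := by ring
  have hchain (f : Numbering X) : ∑ s ∈ initialSegments f, pointWeight β (colorsOf F s) ≤
      omegaCrit G β + c f * L := by
    refine (Finset.sum_congr rfl fun s hs => ?_).trans_le (sum_pointWeight_colorsOf_le hG hsp hβ
      {u ∈ F | f ∈ prefixed u.1} (isChain_initialSegments f))
    rw [colorsOf_filter_mem_prefixed hs]
  refine le_of_mul_le_mul_left ?_ (show (0 : ℝ) < n.factorial from mod_cast n.factorial_pos)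
  calc n.factorial * (colorsOf F).weight β
      ≤ n.choose (n / 2) * ∑ f : Numbering X, ∑ s ∈ initialSegments f,
          pointWeight β (colorsOf F s) := factorial_mul_sum_le fun s => pointWeight_nonneg hβ _
    _ ≤ n.choose (n / 2) * ∑ f : Numbering X, (omegaCrit G β + c f * L) := by
        gcongr with f
        exact hchain f
    _ = n.choose (n / 2) * (n.factorial * omegaCrit G β + (∑ f, (c f : ℝ)) * L) := by
        rw [Finset.sum_add_distrib, Finset.sum_const, card_univ_numbering, nsmul_eq_mul,
          Finset.sum_mul]
    _ ≤ n.choose (n / 2) * (n.factorial * omegaCrit G β +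
          n.factorial * (4 * d / n * chainStateBound G) * L) := by gcongr
    _ = _ := by ring

end CubeWeight

section PartitionSum

variable {P : Type*} [Fintype P] {m : ℕ} {G : Finset (List (Fin m))} {β : Fin m → ℝ}

open Classical in
/-- The sum of the weights `∏ β (c x)`, over the colored points `x`, of all valid colored subsets
`c` of `P`. -/
noncomputable def partitionSum (G : Finset (List (Fin m))) (β : Fin m → ℝ) (P : Type*)
    [Fintype P] [Preorder P] : ℝ :=
  ∑ c : ColoredSubset P m with IsValid G c, ∏ x, (c x).elim 1 β

theorem prod_elim_nonneg (hβ : 0 ≤ β) (c : ColoredSubset P m) : 0 ≤ ∏ x, (c x).elim 1 β :=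
  Finset.prod_nonneg fun x _ => by
    cases c x with
    | none => exact zero_le_one
    | some i => exact hβ i

open Classical in
theorem sum_prod_elim_eq_exp_weight (hβ : 0 ≤ β) (T : Template P m) :
    ∑ c : ColoredSubset P m with ∀ x i, c x = some i → i ∈ T x, ∏ x, (c x).elim 1 β =
      Real.exp (T.weight β) := by
  have hexp (x : P) : Real.exp (pointWeight β (T x)) =
      ∑ o ∈ Finset.insertNone (T x), o.elim 1 β := by
    rw [exp_pointWeight hβ, Finset.sum_insertNone]
    simp
  calc ∑ c : ColoredSubset P m with ∀ x i, c x = some i → i ∈ T x, ∏ x, (c x).elim 1 β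
      = ∑ c ∈ Fintype.piFinset fun x => Finset.insertNone (T x), ∏ x, (c x).elim 1 β := by
        congr 1
        ext c
        simp [Finset.mem_insertNone, Option.mem_def]
    _ = ∏ x, Real.exp (pointWeight β (T x)) := by
        rw [Finset.prod_congr rfl fun x _ => hexp x, Finset.prod_univ_sum]
    _ = Real.exp (T.weight β) := (Real.exp_sum _ _).symm

variable [Preorder P]

theorem exp_weight_le_partitionSum (hβ : 0 ≤ β) {T : Template P m} (hT : T.IsValid G) :
    Real.exp (T.weight β) ≤ partitionSum G β P := by
  classical
  rw [← sum_prod_elim_eq_exp_weight hβ, partitionSum]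
  refine Finset.sum_le_sum_of_subset_of_nonneg
    (Finset.monotone_filter_right _ fun c _ hc => ?_) fun c _ _ => prod_elim_nonneg hβ c
  exact hT.isValid_of_forall_mem hc

theorem weight_le_log_partitionSum (hβ : 0 ≤ β) {T : Template P m} (hT : T.IsValid G) :
    T.weight β ≤ Real.log (partitionSum G β P) := by
  have h := exp_weight_le_partitionSum hβ hT
  exact (Real.le_log_iff_exp_le ((Real.exp_pos _).trans_le h)).2 h

theorem one_le_partitionSum (hG : [] ∉ G) (hβ : 0 ≤ β) : 1 ≤ partitionSum G β P := by
  simpa [Template.weight] using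
    exp_weight_le_partitionSum (P := P) hβ (Template.isValid_empty hG)

theorem partitionSum_le_sum (hβ : 0 ≤ β) {ι : Type*} (s : Finset ι) (T : ι → Template P m)
    (hT : ∀ c : ColoredSubset P m, IsValid G c → ∃ j ∈ s, ∀ x i, c x = some i → i ∈ T j x) :
    partitionSum G β P ≤ ∑ j ∈ s, Real.exp ((T j).weight β) := by
  classical
  let w (c : ColoredSubset P m) : ℝ := ∏ x, (c x).elim 1 β
  have hw (c : ColoredSubset P m) : 0 ≤ w c := prod_elim_nonneg hβ c
  have hcover (c : ColoredSubset P m) (hc : IsValid G c) :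
      w c ≤ ∑ j ∈ s with ∀ x i, c x = some i → i ∈ T j x, w c := by
    obtain ⟨j, hj, hcj⟩ := hT c hc
    exact Finset.single_le_sum (f := fun _ => w c) (fun _ _ => hw c)
      (Finset.mem_filter.2 ⟨hj, hcj⟩)
  calc partitionSum G β P
      ≤ ∑ c : ColoredSubset P m with IsValid G c,
          ∑ j ∈ s with ∀ x i, c x = some i → i ∈ T j x, w c :=
        Finset.sum_le_sum fun c hc => hcover c (Finset.mem_filter.1 hc).2
    _ ≤ ∑ c, ∑ j ∈ s with ∀ x i, c x = some i → i ∈ T j x, w c :=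
        Finset.sum_le_sum_of_subset_of_nonneg (Finset.filter_subset _ _) fun c _ _ =>
          Finset.sum_nonneg fun _ _ => hw c
    _ = ∑ j ∈ s, ∑ c with ∀ x i, c x = some i → i ∈ T j x, w c :=
        Finset.sum_comm' (by simp [and_comm])
    _ = ∑ j ∈ s, Real.exp ((T j).weight β) :=
        Finset.sum_congr rfl fun j _ => sum_prod_elim_eq_exp_weight hβ (T j)

theorem partitionSum_le_card_mul_exp (hβ : 0 ≤ β) {ι : Type*} {s : Finset ι}
    {T : ι → Template P m}
    (hT : ∀ c : ColoredSubset P m, IsValid G c → ∃ j ∈ s, ∀ x i, c x = some i → i ∈ T j x)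
    {B : ℝ} (hB : ∀ j ∈ s, (T j).weight β ≤ B) : partitionSum G β P ≤ #s * Real.exp B := by
  rw [← nsmul_eq_mul]
  exact (partitionSum_le_sum hβ s T hT).trans
    (Finset.sum_le_card_nsmul _ _ _ fun j hj => Real.exp_le_exp.2 (hB j hj))

end PartitionSum

section UpperBound

variable {P : Type*} {m : ℕ} {G : Finset (List (Fin m))} {β : Fin m → ℝ}

/-- The points of the colored subset `c` together with their states. -/
def labelling [Preorder P] (G : Finset (List (Fin m))) (c : ColoredSubset P m) :
    Set (P × State m) :=
  {u | c u.1 = some u.2.1 ∧ u.2.2 = wordsAbove G c u.1}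

theorem isIndepSet_labelling [Preorder P] {c : ColoredSubset P m} (hc : IsValid G c) :
    (conflictGraph P G).IsIndepSet (labelling G c) := by
  rw [isIndepSet_conflictGraph_iff]
  rintro ⟨x, i, A⟩ ⟨hx, hA⟩ ⟨y, j, B⟩ ⟨hy, hB⟩ hxy
  dsimp only at hA hB
  subst hA hB
  exact compatible_wordsAbove hc hxy hx hy

theorem IsContainerMap.exists_labelling_subset [Preorder P] [DecidableEq P]
    [DecidableRel (conflictGraph P G).Adj] {A : Finset (P × State m)} {d : ℕ}
    {F : Finset (P × State m) → Finset (P × State m)}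
    (hF : IsContainerMap (conflictGraph P G) d A F) {c : ColoredSubset P m} (hc : IsValid G c) :
    ∃ S ∈ {S ∈ A.powerset | #S * d ≤ #A}, ∀ u ∈ A, u ∈ labelling G c → u ∈ S ∪ F S := by
  classical
  obtain ⟨S, hS, hcard, hcover⟩ := hF.exists_fingerprint {u ∈ A | u ∈ labelling G c}
    (Finset.filter_subset _ _)
    ((isIndepSet_labelling hc).mono fun u hu => (Finset.mem_filter.1 hu).2)
  exact ⟨S, Finset.mem_filter.2
    ⟨Finset.mem_powerset.2 (hS.trans (Finset.filter_subset _ _)), hcard⟩,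
    fun u hu hlabel => hcover (Finset.mem_filter.2 ⟨hu, hlabel⟩)⟩

variable {X : Type*} [Fintype X] {d : ℕ}
  {F : Finset (Finset X × State m) → Finset (Finset X × State m)}

/-- The pairs of a proper nonempty subset of `X` and a state. The sets `∅` and `X` are left out
because they are comparable with too many other sets. -/
noncomputable def properStates (X : Type*) [Fintype X] [DecidableEq X]
    (G : Finset (List (Fin m))) : Finset (Finset X × State m) :=
  {∅, Finset.univ}ᶜ ×ˢ states G

/-- The pairs of one of the sets `∅`, `X` and a state. -/
noncomputable def extremeStates (X : Type*) [Fintype X] [DecidableEq X]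
    (G : Finset (List (Fin m))) : Finset (Finset X × State m) :=
  {∅, Finset.univ} ×ˢ states G

theorem mem_properStates [DecidableEq X] {u : Finset X × State m} :
    u ∈ properStates X G ↔ (u.1 ≠ ∅ ∧ u.1 ≠ Finset.univ) ∧ u.2 ∈ states G := by
  simp [properStates]

theorem card_properStates_le [DecidableEq X] :
    #(properStates X G) ≤ #(states G) * 2 ^ Fintype.card X := by
  rw [properStates, Finset.card_product, mul_comm, ← Fintype.card_finset]
  exact Nat.mul_le_mul_left _ (Finset.card_le_univ _)

theorem card_properStates_div_le [DecidableEq X] (d : ℕ) :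
    (#(properStates X G) / d : ℝ) ≤ #(states G) * 2 ^ Fintype.card X / d := by
  gcongr
  exact mod_cast card_properStates_le

theorem card_extremeStates_le [DecidableEq X] (hd : 0 < d) (hdX : d ≤ 2 ^ Fintype.card X) :
    (#(extremeStates X G) : ℝ) ≤ 2 * (#(states G) * 2 ^ Fintype.card X / d) := by
  have hd₀ : (0 : ℝ) < d := mod_cast hd
  have hcard : #(extremeStates X G) ≤ 2 * #(states G) := by
    rw [extremeStates, Finset.card_product]
    exact Nat.mul_le_mul_right _ Finset.card_le_two
  calc (#(extremeStates X G) : ℝ) ≤ 2 * #(states G) := mod_cast hcard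
    _ ≤ 2 * (#(states G) * (2 ^ Fintype.card X / d)) := by
        have hone : (1 : ℝ) ≤ 2 ^ Fintype.card X / d := (one_le_div hd₀).2 (mod_cast hdX)
        gcongr
        exact le_mul_of_one_le_right (Nat.cast_nonneg _) hone
    _ = 2 * (#(states G) * 2 ^ Fintype.card X / d) := by ring

theorem mem_colorsOf_of_labelling_subset [DecidableEq X] {c : ColoredSubset (Finset X) m}
    {F : Finset (Finset X × State m)}
    (hF : ∀ u ∈ properStates X G, u ∈ labelling G c → u ∈ F) {s : Finset X} {i : Fin m}
    (hs : c s = some i) : i ∈ colorsOf (F ∪ extremeStates X G) s := by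
  refine mem_colorsOf.2 ⟨wordsAbove G c s, Finset.mem_union.2 ?_⟩
  have hstate := wordsAbove_mem_states (G := G) c s i
  by_cases hext : s ∈ ({∅, Finset.univ} : Finset (Finset X))
  · exact Or.inr (Finset.mem_product.2 ⟨hext, hstate⟩)
  · exact Or.inl (hF _ (Finset.mem_product.2 ⟨Finset.mem_compl.2 hext, hstate⟩) ⟨hs, rfl⟩)

open Classical in
theorem weight_colorsOf_container_le [DecidableEq X] (hG : ∀ g ∈ G, 2 ≤ g.length)
    (hsp : IsSparse G) (hβ : 0 ≤ β)
    (hF : IsContainerMap (conflictGraph (Finset X) G) d (properStates X G) F)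
    (hdX : 4 * d ≤ Fintype.card X) [Nonempty X] (S : Finset (Finset X × State m)) :
    (colorsOf (S ∪ F S ∪ extremeStates X G)).weight β ≤
      (Fintype.card X).choose (Fintype.card X / 2) * (omegaCrit G β +
          4 * d / Fintype.card X * chainStateBound G * pointWeight β Finset.univ) +
        (#S + #(extremeStates X G)) * pointWeight β Finset.univ := by
  have hproper (u) (hu : u ∈ F S) := mem_properStates.1 (hF.subset S hu)
  have hcontainer := weight_colorsOf_le hG hsp hβ (fun u hu => (hproper u hu).1)
    (fun u hu => (hproper u hu).2) (fun u hu => (hF.card_adj_lt S u hu).le) hdX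
  have hextreme := sum_pointWeight_colorsOf_union_le hβ (F S ∪ S) (extremeStates X G) Finset.univ
  have hfingerprint := sum_pointWeight_colorsOf_union_le hβ (F S) S Finset.univ
  rw [Finset.union_comm S]
  simp only [Template.weight, pointWeight] at hcontainer hextreme hfingerprint ⊢
  linarith

theorem log_partitionSum_le (hG : ∀ g ∈ G, 2 ≤ g.length) (hsp : IsSparse G) (hβ : 0 ≤ β)
    (hd : 0 < d) (hdX : 4 * d ≤ Fintype.card X) :
    Real.log (partitionSum G β (Finset X)) ≤
      (Fintype.card X).choose (Fintype.card X / 2) * (omegaCrit G β +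
          4 * d / Fintype.card X * chainStateBound G * pointWeight β Finset.univ) +
        (1 + 3 * pointWeight β Finset.univ + Real.log d) *
          (#(states G) * 2 ^ Fintype.card X / d) := by
  classical
  set n := Fintype.card X
  set L := pointWeight β Finset.univ
  set t : ℝ := #(states G) * 2 ^ n / d
  have : Nonempty X := Fintype.card_pos_iff.1 (by omega)
  have hL : 0 ≤ L := pointWeight_nonneg hβ _
  have : 0 ≤ Real.log d := Real.log_natCast_nonneg d
  have hA : (#(properStates X G) / d : ℝ) ≤ t := card_properStates_div_le d
  have hE : (#(extremeStates X G) : ℝ) ≤ 2 * t :=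
    card_extremeStates_le hd ((show d ≤ n by omega).trans Nat.lt_two_pow_self.le)
  obtain ⟨F, hF⟩ := exists_isContainerMap (conflictGraph (Finset X) G) d (properStates X G)
  have hweight (S) (hS : S ∈ {S ∈ (properStates X G).powerset | #S * d ≤ #(properStates X G)}) :
      (colorsOf (S ∪ F S ∪ extremeStates X G)).weight β ≤
        n.choose (n / 2) * (omegaCrit G β + 4 * d / n * chainStateBound G * L) + 3 * t * L := by
    have hSt : (#S : ℝ) ≤ t :=
      ((le_div_iff₀ (mod_cast hd)).2 (mod_cast (Finset.mem_filter.1 hS).2)).trans hA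
    refine (weight_colorsOf_container_le hG hsp hβ hF hdX S).trans ?_
    gcongr
    linarith
  have hpos : 0 < partitionSum G β (Finset X) :=
    one_pos.trans_le (one_le_partitionSum (fun h => by simpa using hG _ h) hβ)
  refine (Real.log_le_iff_le_exp hpos).2 <| (partitionSum_le_card_mul_exp hβ (fun c hc => ?_)
    hweight).trans ?_
  · obtain ⟨S, hS, hcover⟩ := hF.exists_labelling_subset hc
    exact ⟨S, hS, fun s i => mem_colorsOf_of_labelling_subset hcover⟩
  · have hcount : (#{S ∈ (properStates X G).powerset | #S * d ≤ #(properStates X G)} : ℝ) ≤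
        Real.exp (t * (1 + Real.log d)) := (card_filter_card_mul_le_exp _ hd).trans (by gcongr)
    refine (mul_le_mul_of_nonneg_right hcount (Real.exp_nonneg _)).trans_eq ?_
    rw [← Real.exp_add]
    ring_nf

end UpperBound

section LowerBound

variable {P Q : Type*} [PartialOrder P] [PartialOrder Q] {m : ℕ} {G : Finset (List (Fin m))}
  {β : Fin m → ℝ}

theorem Template.IsValid.extend {T : Template Q m} (hT : T.IsValid G) (e : Q ↪o P) :
    Template.IsValid G (Function.extend e T fun _ => ∅) := by
  rw [Template.isValid_iff] at hT ⊢
  intro g hg x hx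
  by_contra! hcol
  have hrange (j) : ∃ y, e y = x j := by
    by_contra hj
    simpa [Function.extend_apply' _ _ _ hj] using hcol j
  choose y hy using hrange
  obtain ⟨j, hj⟩ := hT g hg y fun a b hab => e.lt_iff_lt.1 (by simpa only [hy] using hx hab)
  refine hj ?_
  simpa only [← hy, e.injective.extend_apply] using hcol j

variable {X : Type*} [Fintype X]

theorem weight_comp_card (T : Template ℕ m) :
    Template.weight β (fun s : Finset X => T #s) =
      ∑ a ∈ Finset.range (Fintype.card X + 1),
        (Fintype.card X).choose a * pointWeight β (T a) := by
  have hsum := Finset.sum_powerset_apply_card (x := (Finset.univ : Finset X))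
    fun a => pointWeight β (T a)
  simp only [Finset.powerset_univ, Finset.card_univ, nsmul_eq_mul] at hsum
  exact hsum

theorem sum_range_extend {l : ℕ} (n : ℕ) (e : Fin l ↪o ℕ) (T : Template (Fin l) m) :
    ∑ a ∈ Finset.range (n + 1), n.choose a * pointWeight β (Function.extend e T (fun _ => ∅) a) =
      ∑ j, n.choose (e j) * pointWeight β (T j) := by
  classical
  calc _ = ∑ a ∈ Finset.univ.image e,
          n.choose a * pointWeight β (Function.extend e T (fun _ => ∅) a) := by
        refine Finset.sum_congr_of_eq_on_inter (fun a _ ha => ?_) (fun a _ ha => ?_)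
          fun _ _ _ => rfl
        · rw [Function.extend_apply' _ _ _ (by simpa using ha), pointWeight_empty, mul_zero]
        · rw [Nat.choose_eq_zero_of_lt (by simpa using ha), Nat.cast_zero, zero_mul]
    _ = _ := by
        rw [Finset.sum_image e.injective.injOn]
        simp only [e.injective.extend_apply]

theorem sum_choose_mul_le_log_partitionSum (hβ : 0 ≤ β) {l : ℕ} {T : Template (Fin l) m}
    (hT : T.IsValid G) (k : ℕ) :
    ∑ j : Fin l, (Fintype.card X).choose (k + j) * pointWeight β (T j) ≤
      Real.log (partitionSum G β (Finset X)) := by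
  let e : Fin l ↪o ℕ := Fin.valOrderEmb l |>.trans (OrderEmbedding.addLeft k)
  have h := weight_le_log_partitionSum hβ ((hT.extend e).comp (Finset.card_strictMono (α := X)))
  exact ((sum_range_extend _ e T).symm.trans (weight_comp_card _).symm).trans_le h

end LowerBound

section Expectation

variable {P : Type*} {m : ℕ} {G : Finset (List (Fin m))} {p : Fin m → ℝ}

/-- The colored subset `c` carries the colors it inherits from the partial coloring `χ`. -/
def IsRestriction (χ : P → Option (Fin m)) (c : ColoredSubset P m) : Prop :=
  ∀ x, c x ≠ none → χ x = c x

theorem isRestriction_restrict (χ : P → Option (Fin m)) (S : Set P) :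
    IsRestriction χ (restrict χ S) := fun x hx => by
  simp_all [restrict]

theorem restrict_support {χ : P → Option (Fin m)} {c : ColoredSubset P m}
    (hc : IsRestriction χ c) : restrict χ {x | c x ≠ none} = c := by
  funext x
  by_cases hx : c x = none
  · simp [restrict, hx]
  · simp [restrict, hx, hc x hx]

theorem support_restrict {χ : P → Option (Fin m)} {S : Set P} (hS : ∀ x ∈ S, χ x ≠ none) :
    {x | restrict χ S x ≠ none} = S := by
  ext x
  simpa [restrict] using hS x

open Classical in
theorem numValid_eq_card [Fintype P] [Preorder P] (χ : P → Option (Fin m)) :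
    numValid G χ = #{c : ColoredSubset P m | IsValid G c ∧ IsRestriction χ c} := by
  rw [numValid, ← Set.ncard_coe_finset, Finset.coe_filter_univ]
  refine Set.ncard_congr (fun S _ => restrict χ S)
    (fun S hS => ⟨hS.2, isRestriction_restrict χ S⟩) (fun S S' hS hS' h => ?_) fun c hc => ?_
  · rw [← support_restrict hS.1, h, support_restrict hS'.1]
  · refine ⟨{x | c x ≠ none}, ⟨fun x hx => ?_, ?_⟩, restrict_support hc.2⟩
    · rwa [hc.2 x hx]
    · rw [restrict_support hc.2]
      exact hc.1

theorem setOf_isRestriction_eq_biInter {Ω : Type*} (χ : P → Ω → Option (Fin m))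
    (c : ColoredSubset P m) :
    {ω | IsRestriction (χ · ω) c} = ⋂ x ∈ {x | c x ≠ none}, χ x ⁻¹' {c x} := by
  ext ω
  simp [IsRestriction]

variable {Ω : Type*} [MeasurableSpace Ω] {μ : Measure Ω} {χ : P → Ω → Option (Fin m)}

theorem IsRandomColoring.measurableSet_isRestriction [Countable P]
    (hχ : IsRandomColoring p μ χ) (c : ColoredSubset P m) :
    MeasurableSet {ω | IsRestriction (χ · ω) c} := by
  rw [setOf_isRestriction_eq_biInter]
  exact MeasurableSet.biInter (Set.to_countable _) fun x _ => hχ.measurable x trivial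

theorem IsRandomColoring.measureReal_isRestriction [Fintype P] (hp : 0 ≤ p)
    (hχ : IsRandomColoring p μ χ) (c : ColoredSubset P m) :
    μ.real {ω | IsRestriction (χ · ω) c} = ∏ x, (c x).elim 1 p := by
  classical
  have hinter : {ω | IsRestriction (χ · ω) c} =
      ⋂ x ∈ ({x | c x ≠ none} : Finset P), χ x ⁻¹' {c x} := by
    rw [setOf_isRestriction_eq_biInter]
    simp only [Finset.mem_filter_univ, Set.mem_ofPred_eq]
  rw [hinter, Measure.real, (iIndepFun_iff_measure_inter_preimage_eq_mul.1 hχ.indep) _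
    (sets := fun x => {c x}) fun _ _ => trivial, ENNReal.toReal_prod, Finset.prod_filter]
  refine Finset.prod_congr rfl fun x _ => ?_
  cases hx : c x with
  | none => simp
  | some i =>
    have hprob : (μ (χ x ⁻¹' {some i})).toReal = p i :=
      (congrArg ENNReal.toReal (hχ.prob x i)).trans (ENNReal.toReal_ofReal (hp i))
    simpa using hprob

theorem IsRandomColoring.integral_numValid [Fintype P] [Preorder P] [IsFiniteMeasure μ]
    (hp : 0 ≤ p) (hχ : IsRandomColoring p μ χ) :
    ∫ ω, (numValid G (χ · ω) : ℝ) ∂μ = partitionSum G p P := by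
  classical
  have hcount (ω : Ω) : (numValid G (χ · ω) : ℝ) =
      ∑ c : ColoredSubset P m with IsValid G c,
        Set.indicator {ω | IsRestriction (χ · ω) c} (fun _ => (1 : ℝ)) ω := by
    simp [numValid_eq_card, ← Finset.filter_filter, Set.indicator_apply]
  have hmeas := hχ.measurableSet_isRestriction
  simp_rw [hcount]
  rw [integral_finsetSum _ fun c _ => (integrable_const _).indicator (hmeas c), partitionSum]
  refine Finset.sum_congr rfl fun c _ => ?_
  rw [integral_indicator_const _ (hmeas c), hχ.measureReal_isRestriction hp, smul_eq_mul, mul_one]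

end Expectation

section Binomials

theorem sixteen_pow_le_mul_centralBinom_sq {k : ℕ} (hk : 0 < k) :
    16 ^ k ≤ 4 * k * k.centralBinom ^ 2 := by
  induction k, hk using Nat.le_induction with
  | base => decide
  | succ k _ ih =>
    refine le_of_mul_le_mul_left ?_ k.succ_pos
    calc (k + 1) * 16 ^ (k + 1) = 16 * (k + 1) * 16 ^ k := by ring
      _ ≤ 16 * (k + 1) * (4 * k * k.centralBinom ^ 2) := by gcongr
      _ = 16 * k.centralBinom ^ 2 * (4 * (k * (k + 1))) := by ring
      _ ≤ 16 * k.centralBinom ^ 2 * (2 * k + 1) ^ 2 := by gcongr; linarith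
      _ = 4 * (2 * (2 * k + 1) * k.centralBinom) ^ 2 := by ring
      _ = 4 * ((k + 1) * (k + 1).centralBinom) ^ 2 := by rw [Nat.succ_mul_centralBinom_succ]
      _ = (k + 1) * (4 * (k + 1) * (k + 1).centralBinom ^ 2) := by ring

theorem centralBinom_succ_eq_two_mul_choose (k : ℕ) :
    (k + 1).centralBinom = 2 * (2 * k + 1).choose k := by
  rw [Nat.centralBinom_eq_two_mul_choose, Nat.mul_succ, Nat.choose_succ_succ',
    Nat.choose_symm_half, ← two_mul]

theorem four_pow_le_mul_choose_half_sq {n : ℕ} (hn : 0 < n) :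
    4 ^ n ≤ 4 * n * n.choose (n / 2) ^ 2 := by
  obtain ⟨k, rfl | rfl⟩ := Nat.even_or_odd' n
  · calc 4 ^ (2 * k) = 16 ^ k := by rw [pow_mul]; norm_num
      _ ≤ 4 * k * k.centralBinom ^ 2 := sixteen_pow_le_mul_centralBinom_sq (by omega)
      _ ≤ 4 * (2 * k) * k.centralBinom ^ 2 := by gcongr; omega
      _ = _ := by rw [Nat.centralBinom_eq_two_mul_choose, Nat.mul_div_cancel_left _ two_pos]
  · have hodd := sixteen_pow_le_mul_centralBinom_sq k.succ_pos
    rw [Nat.succ_eq_add_one, centralBinom_succ_eq_two_mul_choose] at hodd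
    rw [show (2 * k + 1) / 2 = k by omega]
    refine le_of_mul_le_mul_left ?_ four_pos
    calc 4 * 4 ^ (2 * k + 1) = 16 ^ (k + 1) := by
          rw [show (16 : ℕ) = 4 ^ 2 by norm_num, ← pow_mul]; ring
      _ ≤ 4 * (k + 1) * (2 * (2 * k + 1).choose k) ^ 2 := hodd
      _ = 4 * (4 * (k + 1) * (2 * k + 1).choose k ^ 2) := by ring
      _ ≤ 4 * (4 * (2 * k + 1) * (2 * k + 1).choose k ^ 2) := by gcongr; omega

theorem two_pow_le_mul_choose_half {n : ℕ} (hn : 0 < n) :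
    (2 : ℝ) ^ n ≤ 2 * √n * n.choose (n / 2) := by
  have hfour : (4 : ℝ) ^ n ≤ 4 * n * n.choose (n / 2) ^ 2 :=
    mod_cast four_pow_le_mul_choose_half_sq hn
  refine le_of_sq_le_sq ?_ (by positivity)
  calc ((2 : ℝ) ^ n) ^ 2 = 4 ^ n := by rw [← pow_mul, mul_comm, pow_mul]; norm_num
    _ ≤ 4 * n * n.choose (n / 2) ^ 2 := hfour
    _ = (2 * √n * n.choose (n / 2)) ^ 2 := by
        rw [mul_pow, mul_pow, Real.sq_sqrt n.cast_nonneg]; norm_num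

theorem tendsto_sub_half_div_half (j : ℕ) :
    Tendsto (fun n : ℕ => ((n - (n / 2 + j) : ℕ) : ℝ) / (n / 2 + j + 1 : ℕ)) atTop (𝓝 1) := by
  have hpos (n : ℕ) : (0 : ℝ) < (n / 2 + j + 1 : ℕ) := by positivity
  have herror : Tendsto (fun n : ℕ => (2 * j + 2 : ℝ) / (n / 2 + j + 1 : ℕ)) atTop (𝓝 0) :=
    tendsto_const_nhds.div_atTop <| tendsto_natCast_atTop_atTop.comp <|
      tendsto_atTop_mono (fun n => by omega) (Nat.tendsto_div_const_atTop two_ne_zero)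
  have hlower := herror.const_sub 1
  rw [sub_zero] at hlower
  refine tendsto_of_tendsto_of_tendsto_of_le_of_le hlower tendsto_const_nhds (fun n => ?_)
    fun n => ?_
  · change 1 - _ / _ ≤ _ / _
    rw [one_sub_div (hpos n).ne', div_le_div_iff_of_pos_right (hpos n), sub_le_iff_le_add]
    exact mod_cast (show n / 2 + j + 1 ≤ n - (n / 2 + j) + (2 * j + 2) by omega)
  · exact (div_le_one (hpos n)).2 (mod_cast show n - (n / 2 + j) ≤ n / 2 + j + 1 by omega)

theorem tendsto_choose_div_choose (j : ℕ) :
    Tendsto (fun n : ℕ => (n.choose (n / 2 + j) : ℝ) / n.choose (n / 2)) atTop (𝓝 1) := by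
  induction j with
  | zero =>
    refine tendsto_const_nhds.congr fun n => (div_self ?_).symm
    exact mod_cast (Nat.choose_pos (Nat.div_le_self n 2)).ne'
  | succ j ih =>
    have hmul := ih.mul (tendsto_sub_half_div_half j)
    rw [mul_one] at hmul
    refine hmul.congr fun n => ?_
    have hpos : ((n / 2 + j + 1 : ℕ) : ℝ) ≠ 0 := by positivity
    have hsucc : (n.choose (n / 2 + j + 1) : ℝ) * (n / 2 + j + 1 : ℕ) =
        n.choose (n / 2 + j) * (n - (n / 2 + j) : ℕ) :=
      mod_cast Nat.choose_succ_right_eq n (n / 2 + j)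
    rw [← add_assoc, div_mul_div_comm, ← hsucc, mul_div_mul_right _ _ hpos]

end Binomials

section Asymptotics

/-- The degree bound `n ^ (3 / 4)` for the containers. It has to be `o(n)`, so that containers are
almost conflict-free along chains, and of larger order than `√n * log n`, so that there are only
`exp (o (n.choose (n / 2)))` fingerprints. -/
noncomputable def degreeBound (n : ℕ) : ℕ := ⌈(n : ℝ) ^ (3 / 4 : ℝ)⌉₊

theorem degreeBound_pos {n : ℕ} (hn : 0 < n) : 0 < degreeBound n :=
  Nat.ceil_pos.2 (Real.rpow_pos_of_pos (mod_cast hn) _)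

theorem degreeBound_le {n : ℕ} (hn : 0 < n) : degreeBound n ≤ n := by
  refine Nat.ceil_le.2 ((Real.rpow_le_rpow_of_exponent_le (mod_cast hn) ?_).trans_eq
    (Real.rpow_one _))
  norm_num

theorem tendsto_degreeBound_div : Tendsto (fun n : ℕ => (degreeBound n : ℝ) / n) atTop (𝓝 0) := by
  have hlimit : Tendsto (fun n : ℕ => (n : ℝ) ^ (-(1 / 4) : ℝ) + 1 / n) atTop (𝓝 0) := by
    simpa using ((tendsto_rpow_neg_atTop (show (0 : ℝ) < 1 / 4 by norm_num)).comp
      tendsto_natCast_atTop_atTop).add tendsto_one_div_atTop_nhds_zero_nat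
  refine squeeze_zero' (Eventually.of_forall fun n => by positivity) ?_ hlimit
  filter_upwards [eventually_gt_atTop 0] with n hn
  have hn₀ : (n : ℝ) ≠ 0 := mod_cast hn.ne'
  calc (degreeBound n : ℝ) / n ≤ ((n : ℝ) ^ (3 / 4 : ℝ) + 1) / n := by
        gcongr
        exact (Nat.ceil_lt_add_one (by positivity)).le
    _ = (n : ℝ) ^ (-(1 / 4) : ℝ) + 1 / n := by
        rw [add_div, ← Real.rpow_sub_one hn₀]
        norm_num

theorem two_pow_div_degreeBound_le {n : ℕ} (hn : 0 < n) :
    (2 : ℝ) ^ n / degreeBound n / n.choose (n / 2) ≤ 2 * (n : ℝ) ^ (-(1 / 4) : ℝ) := by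
  have hn₀ : (0 : ℝ) < n := mod_cast hn
  have hN : (0 : ℝ) < n.choose (n / 2) := mod_cast Nat.choose_pos (Nat.div_le_self n 2)
  rw [div_div, div_le_iff₀ (mul_pos (mod_cast degreeBound_pos hn) hN)]
  calc (2 : ℝ) ^ n ≤ 2 * √n * n.choose (n / 2) := two_pow_le_mul_choose_half hn
    _ = 2 * (n : ℝ) ^ (-(1 / 4) : ℝ) * ((n : ℝ) ^ (3 / 4 : ℝ) * n.choose (n / 2)) := by
        rw [Real.sqrt_eq_rpow, show (1 / 2 : ℝ) = -(1 / 4) + 3 / 4 by norm_num,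
          Real.rpow_add hn₀]
        ring
    _ ≤ 2 * (n : ℝ) ^ (-(1 / 4) : ℝ) * (degreeBound n * n.choose (n / 2)) := by
        gcongr
        exact Nat.le_ceil _

theorem tendsto_add_log_mul_rpow_neg (c : ℝ) {s : ℝ} (hs : 0 < s) :
    Tendsto (fun x : ℝ => (c + Real.log x) * x ^ (-s)) atTop (𝓝 0) := by
  have hlog := (isLittleO_log_rpow_atTop hs).tendsto_div_nhds_zero
  have hsum := ((tendsto_rpow_neg_atTop hs).const_mul c).add hlog
  rw [mul_zero, add_zero] at hsum
  refine hsum.congr' ?_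
  filter_upwards [eventually_ge_atTop 0] with x hx
  rw [Real.rpow_neg hx]
  ring

theorem tendsto_add_log_degreeBound_mul {c : ℝ} (hc : 0 ≤ c) :
    Tendsto (fun n : ℕ => (c + Real.log (degreeBound n)) *
      ((2 : ℝ) ^ n / degreeBound n / n.choose (n / 2))) atTop (𝓝 0) := by
  have hlimit := ((tendsto_add_log_mul_rpow_neg c (show (0 : ℝ) < 1 / 4 by norm_num)).comp
    tendsto_natCast_atTop_atTop).const_mul 2
  rw [mul_zero] at hlimit
  have hlog (n : ℕ) : 0 ≤ Real.log (degreeBound n) := Real.log_natCast_nonneg _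
  refine squeeze_zero' (Eventually.of_forall fun n => ?_) ?_ hlimit
  · have := hlog n
    positivity
  · filter_upwards [eventually_gt_atTop 0] with n hn
    have hlogn : Real.log (degreeBound n) ≤ Real.log n :=
      Real.log_le_log (mod_cast degreeBound_pos hn) (mod_cast degreeBound_le hn)
    calc _ ≤ (c + Real.log n) * (2 * (n : ℝ) ^ (-(1 / 4) : ℝ)) := by
          have := (hlog n).trans hlogn
          gcongr
          exact two_pow_div_degreeBound_le hn
      _ = _ := by simp only [Function.comp_apply]; ring

variable {m : ℕ} {G : Finset (List (Fin m))} {β : Fin m → ℝ}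

theorem exists_tendsto_and_log_partitionSum_div_le (hG : ∀ g ∈ G, 2 ≤ g.length)
    (hsp : IsSparse G) (hβ : 0 ≤ β) :
    ∃ u : ℕ → ℝ, Tendsto u atTop (𝓝 (omegaCrit G β)) ∧ ∀ᶠ n in atTop,
      Real.log (partitionSum G β (Finset (Fin n))) / n.choose (n / 2) ≤ u n := by
  set K : ℝ := ((chainStateBound G : ℕ) : ℝ)
  set L := pointWeight β Finset.univ
  have hL : 0 ≤ L := pointWeight_nonneg hβ _
  refine ⟨fun n => omegaCrit G β + 4 * (degreeBound n / n) * K * L +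
    #(states G) * ((1 + 3 * L + Real.log (degreeBound n)) *
      ((2 : ℝ) ^ n / degreeBound n / n.choose (n / 2))), ?_, ?_⟩
  · have hdegree := ((tendsto_degreeBound_div.const_mul 4).mul_const K).mul_const L
    have hcount := (tendsto_add_log_degreeBound_mul (c := 1 + 3 * L) (by positivity)).const_mul
      (#(states G) : ℝ)
    simpa using (hdegree.const_add (omegaCrit G β)).add hcount
  · filter_upwards [eventually_gt_atTop 0, tendsto_degreeBound_div.eventually_le_const
      (show (0 : ℝ) < 1 / 4 by norm_num)] with n hn hdn
    have hN : (0 : ℝ) < n.choose (n / 2) := mod_cast Nat.choose_pos (Nat.div_le_self n 2)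
    have hdn' : 4 * degreeBound n ≤ n := by
      rw [div_le_iff₀ (mod_cast hn)] at hdn
      exact_mod_cast (by linarith : (4 * degreeBound n : ℝ) ≤ n)
    have hle := log_partitionSum_le (X := Fin n) hG hsp hβ (degreeBound_pos hn)
      (by rwa [Fintype.card_fin])
    rw [Fintype.card_fin] at hle
    rw [div_le_iff₀ hN]
    refine hle.trans_eq ?_
    simp only [K, L]
    field_simp

theorem tendsto_log_partitionSum_div (hG : ∀ g ∈ G, 2 ≤ g.length) (hsp : IsSparse G)
    (hβ : 0 ≤ β) :
    Tendsto (fun n : ℕ => Real.log (partitionSum G β (Finset (Fin n))) / n.choose (n / 2)) atTop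
      (𝓝 (omegaCrit G β)) := by
  obtain ⟨u, hu, hle⟩ := exists_tendsto_and_log_partitionSum_div_le hG hsp hβ
  obtain ⟨l, T, hT, hw⟩ := (isGreatest_omegaCrit (fun h => by simpa using hG _ h) hsp β).1
  have hlower : Tendsto (fun n : ℕ => ∑ j : Fin l, (n.choose (n / 2 + j) : ℝ) / n.choose (n / 2) *
      pointWeight β (T j)) atTop (𝓝 (omegaCrit G β)) := by
    rw [← hw, Template.weight]
    refine tendsto_finsetSum _ fun j _ => ?_
    have hj := (tendsto_choose_div_choose j).mul_const (pointWeight β (T j))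
    rwa [one_mul] at hj
  refine tendsto_of_tendsto_of_tendsto_of_le_of_le' hlower hu (Eventually.of_forall fun n => ?_) hle
  have hsum := sum_choose_mul_le_log_partitionSum (X := Fin n) hβ hT (n / 2)
  rw [Fintype.card_fin] at hsum
  simp only [div_mul_eq_mul_div, ← Finset.sum_div]
  gcongr

theorem Template.isValid_of_subsingleton {P : Type*} [Preorder P] [Subsingleton P]
    (hG : ∀ g ∈ G, 2 ≤ g.length) (T : Template P m) : T.IsValid G :=
  isValid_iff.2 fun g hg x hx => by
    have hlen := hG g hg
    have hlt : x ⟨0, by omega⟩ < x ⟨1, by omega⟩ := hx (by simp)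
    exact absurd (Subsingleton.elim _ _) hlt.ne

theorem log_one_add_le_omegaCrit (hG : ∀ g ∈ G, 2 ≤ g.length) (hsp : IsSparse G) (β : Fin m → ℝ)
    (i : Fin m) : Real.log (1 + β i) ≤ omegaCrit G β := by
  have hT : Template.IsValid G fun _ : Unit => {i} := Template.isValid_of_subsingleton hG _
  simpa [pointWeight] using
    sum_pointWeight_le_omegaCrit hsp hT (C := {()}) (by simp) β

theorem eq_zero_of_omegaCrit_eq_zero (hG : ∀ g ∈ G, 2 ≤ g.length) (hsp : IsSparse G)
    (hβ : 0 ≤ β) (hω : omegaCrit G β = 0) : β = 0 := by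
  funext i
  by_contra hi
  have hpos : 0 < β i := (hβ i).lt_of_ne' hi
  have hlog : 0 < Real.log (1 + β i) := Real.log_pos (by linarith)
  exact hlog.not_ge (hω ▸ log_one_add_le_omegaCrit hG hsp β i)

theorem partitionSum_zero {P : Type*} [Fintype P] [Preorder P] (hG : [] ∉ G) :
    partitionSum G 0 P = 1 := by
  refine le_antisymm ?_ (one_le_partitionSum hG le_rfl)
  have hle := partitionSum_le_card_mul_exp (G := G) (P := P) (s := {()})
    (T := fun _ _ => Finset.univ) (B := 0) (le_refl (0 : Fin m → ℝ)) (by simp)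
    (by simp [Template.weight])
  simpa using hle

theorem exists_eq_exp_mul_one_add {Z N : ℕ → ℝ} {w : ℝ} (hZ : ∀ n, 0 < Z n) (hN : ∀ n, N n ≠ 0)
    (hlim : Tendsto (fun n => Real.log (Z n) / N n) atTop (𝓝 w)) (hw : w = 0 → ∀ n, Z n = 1) :
    ∃ ε : ℕ → ℝ, Tendsto ε atTop (𝓝 0) ∧ ∀ n, Z n = Real.exp (w * N n * (1 + ε n)) := by
  by_cases hw₀ : w = 0
  · exact ⟨0, tendsto_const_nhds, fun n => by simp [hw₀, hw hw₀ n]⟩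
  · refine ⟨fun n => Real.log (Z n) / N n / w - 1, ?_, fun n => ?_⟩
    · simpa [hw₀] using (hlim.div_const w).sub_const 1
    · have hexponent : w * N n * (1 + (Real.log (Z n) / N n / w - 1)) = Real.log (Z n) := by
        have := hN n
        field_simp
        ring
      rw [hexponent, Real.exp_log (hZ n)]

theorem exists_partitionSum_eq_exp (hG : ∀ g ∈ G, 2 ≤ g.length) (hsp : IsSparse G)
    (hβ : 0 ≤ β) :
    ∃ ε : ℕ → ℝ, Tendsto ε atTop (𝓝 0) ∧ ∀ n, partitionSum G β (Finset (Fin n)) =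
      Real.exp (omegaCrit G β * (n.choose (n / 2) : ℝ) * (1 + ε n)) := by
  have hnil : [] ∉ G := fun h => by simpa using hG _ h
  refine exists_eq_exp_mul_one_add (fun n => one_pos.trans_le (one_le_partitionSum hnil hβ))
    (fun n => mod_cast (Nat.choose_pos (Nat.div_le_self n 2)).ne')
    (tendsto_log_partitionSum_div hG hsp hβ) fun hω n => ?_
  rw [eq_zero_of_omegaCrit_eq_zero hG hsp hβ hω, partitionSum_zero hnil]

end Asymptotics

end ColoredChains

theorem mainTheorem3 (m : ℕ) (G : Finset (List (Fin m))) (hG : ∀ g ∈ G, 2 ≤ g.length)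
    (hsparse : ColoredChains.IsSparse G) (p : Fin m → ℝ) (hp : ∀ i, 0 ≤ p i) (hp1 : ∑ i, p i ≤ 1) :
    IsGreatest (ColoredChains.chainWeights G p) (ColoredChains.omegaCrit G p) ∧
    ∃ ε : ℕ → ℝ, Tendsto ε atTop (𝓝 0) ∧
      ∀ (n : ℕ) (Ω : Type*) [MeasurableSpace Ω] (μ : Measure Ω) [IsProbabilityMeasure μ]
        (χ : Finset (Fin n) → Ω → Option (Fin m)), ColoredChains.IsRandomColoring p μ χ →
        ∫ ω, (ColoredChains.numValid G (fun x => χ x ω) : ℝ) ∂μ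
          = Real.exp (ColoredChains.omegaCrit G p * (n.choose (n / 2) : ℝ) * (1 + ε n)) := by
  refine ⟨ColoredChains.isGreatest_omegaCrit (fun h => by simpa using hG _ h) hsparse p, ?_⟩
  obtain ⟨ε, hε, hexp⟩ := ColoredChains.exists_partitionSum_eq_exp hG hsparse hp
  exact ⟨ε, hε, fun n Ω _ μ _ χ hχ => (hχ.integral_numValid hp).trans (hexp n)⟩
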